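/- **Theorem (Zudilin's identity).** For complex $z$ and complex parameters put $$J_m\left[\begin{matrix}a_0,a_1,\dots,a_m\\ b_1,\dots,b_m\end{matrix};z\right]=\int_{[0,1]^m}\frac{\prod_{i=1}^m x_i^{a_i-1}(1-x_i)^{b_i-a_i-1}}{\bigl(1-(1-(\cdots(1-x_m)x_{m-1})\cdots)x_1z\bigr)^{a_0}}\,dx_1\cdots dx_m$$ (the denominator being $(1-x_1z)^{a_0}$ for $m=1$), and $${}_{p+1}F_p\left[\begin{matrix}\alpha_0,\dots,\alpha_p\\ \beta_1,\dots,\beta_p\end{matrix};z\right]=\sum_{k=0}^\infty\frac{(\alpha_0)_k\cdots(\alpha_p)_k}{k!\,(\beta_1)_k\cdots(\beta_p)_k}z^k,\qquad \beta_j\notin\mathbb Z_{\le0},$$ where $(x)_0=1$ and $(x)_k=x(x+1)\cdots(x+k-1)$ for $k\ge1$. Let $m\ge1$ be an integer and let $h_0,h_1,\dots,h_{m+2}$ be complex numbers such that - $1+\operatorname{Re}(h_0)>\frac{2}{m+1}\sum_{j=1}^{m+2}\operatorname{Re}(h_j)$, - $\operatorname{Re}(1+h_0-h_{j+1})>\operatorname{Re}(h_j)>0$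 for $j=2,3,\dots,m+1$, - $\operatorname{Re}(1+h_0-h_3-h_2)\ge\operatorname{Re}(h_1)$, - $h_0\neq0$ and, if $m=1$, none of $h_0$, $1+h_0-h_1$, $1+h_0-h_2$, $1+h_0-h_1-h_2$ is a non-positive integer. Then the integral and the series below converge absolutely, no lower parameter of the series is a non-positive integer, no Gamma factor in a numerator has a pole, and $$J_m\left[\begin{matrix}h_1,h_2,\dots,h_{m+1}\\ 1+h_0-h_3,\dots,1+h_0-h_{m+2}\end{matrix};1\right]=\frac{\Gamma(1+h_0)\prod_{j=2}^{m+1}\Gamma(h_j)}{\prod_{j=1}^{m+2}\Gamma(1+h_0-h_j)}\left(\prod_{j=1}^{m+1}\Gamma(1+h_0-h_j-h_{j+1})\right)\;{}_{m+4}F_{m+3}\left[\begin{matrix}h_0,\tfrac12h_0+1,h_1,\dots,h_{m+2}\\ \tfrac12h_0,1+h_0-h_1,\dots,1+h_0-h_{m+2}\end{matrix};(-1)^{m+1}\right].$$ -/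

import Mathlib

noncomputable section

namespace VasilyevZudilin

/-- The generalized hypergeometric series `_{p+1}F_p` with upper parameters `α 0, …, α p` and lower
parameters `β 0, …, β (p-1)`: its `k`-th term at `z`. -/
def hypTerm {p : ℕ} (α : Fin (p + 1) → ℂ) (β : Fin p → ℂ) (z : ℂ) (k : ℕ) : ℂ :=
  (∏ i, (ascPochhammer ℂ k).eval (α i)) /
    ((k.factorial : ℂ) * ∏ i, (ascPochhammer ℂ k).eval (β i)) * z ^ k

/-- The value of the series `_{p+1}F_p` with upper parameters `α` and lower parameters `β`
at `z`. -/
def hypF {p : ℕ} (α : Fin (p + 1) → ℂ) (β : Fin p → ℂ) (z : ℂ) : ℂ :=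
  ∑' k : ℕ, hypTerm α β z k

/-- The nested expression `1 - (⋯ (1 - (1 - x_m) x_{m-1}) ⋯) x_1`, equal to `1` for `m = 0`. -/
def nested : (m : ℕ) → (Fin m → ℝ) → ℝ
  | 0, _ => 1
  | m + 1, x => 1 - nested m (Fin.tail x) * x 0

/-- The denominator `1 - (1 - (⋯ (1 - x_m) x_{m-1}) ⋯) x_1 z` (equal to `1 - x_1 z` for `m = 1`,
and to `1` for `m = 0`). -/
def vasQ : (m : ℕ) → (Fin m → ℝ) → ℂ → ℂ
  | 0, _, _ => 1
  | m + 1, x, z => 1 - (nested m (Fin.tail x) : ℂ) * (x 0 : ℂ) * z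

/-- The integrand of the Vasilyev-type integral, with parameters `a_0 = a 0`,
`a_i = a i.succ` and `b_i = b i` for the `i`-th variable. -/
def vasIntegrand {m : ℕ} (a : Fin (m + 1) → ℂ) (b : Fin m → ℂ) (z : ℂ) (x : Fin m → ℝ) : ℂ :=
  (∏ i, (x i : ℂ) ^ (a i.succ - 1) * (1 - (x i : ℂ)) ^ (b i - a i.succ - 1)) /
    vasQ m x z ^ a 0

/-- The Vasilyev-type integral `J_m` over the unit cube `[0,1]^m`. -/
def vasJ {m : ℕ} (a : Fin (m + 1) → ℂ) (b : Fin m → ℂ) (z : ℂ) : ℂ :=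
  ∫ x in Set.Icc (0 : Fin m → ℝ) 1, vasIntegrand a b z x

/-- `s` is one of `0, -1, -2, …`. -/
def IsNonposInt (s : ℂ) : Prop := ∃ n : ℕ, s = -(n : ℂ)

/-- The upper parameters `h_1, …, h_{m+1}` of the integral. -/
def upperJ (m : ℕ) (h : ℕ → ℂ) : Fin (m + 1) → ℂ := fun i => h (i + 1)

/-- The lower parameters `1 + h_0 - h_3, …, 1 + h_0 - h_{m+2}` of the integral. -/
def lowerJ (m : ℕ) (h : ℕ → ℂ) : Fin m → ℂ := fun i => 1 + h 0 - h (i + 3)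

/-- The upper parameters `h_0, h_0/2 + 1, h_1, …, h_{m+2}` of the very-well-poised series. -/
def upperF (m : ℕ) (h : ℕ → ℂ) : Fin (m + 4) → ℂ :=
  Fin.cons (h 0) (Fin.cons (h 0 / 2 + 1) (fun i : Fin (m + 2) => h (i + 1)))

/-- The lower parameters `h_0/2, 1 + h_0 - h_1, …, 1 + h_0 - h_{m+2}` of the very-well-poised
series. -/
def lowerF (m : ℕ) (h : ℕ → ℂ) : Fin (m + 3) → ℂ :=
  Fin.cons (h 0 / 2) (fun i : Fin (m + 2) => 1 + h 0 - h (i + 1))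

end VasilyevZudilin

end

/-! Write `a = h 0`. Expanding the denominator by the binomial series and integrating out the first
variable gives a beta integral times an integral of the same shape in one dimension less, whose
denominator exponent is `-k`. Everything therefore rests on the terminating integrals, with exponent
`-n`, and these obey the same recursion with finite sums.

That recursion is Bailey's lemma at `q = 1`. For `β_k = ∑_l α_l / ((k-l)! (1+a)_{k+l})`, the sum
`∑_k (b)_k (c)_k β_k` equals a Gamma factor times `∑_l (b)_l (c)_l / ((1+a-b)_l (1+a-c)_l) α_l`:
interchange the summations and evaluate the inner sum by Gauss's theorem, or by Chu–Vandermonde when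
`b = -n`. The beta exponents of the integral are well-poised, so the denominators produced by the
beta integrals cancel the normalisation of the terminating values and leave exactly the left side of
Bailey's lemma. Each application of the terminating lemma (`bailey_finite`) inserts one more
parameter, and a sign `(-1)^l`, into `α`. The chain starts from the unit pair (`unit_bailey`), and
`terminatingIdentity` is the resulting induction on the dimension.

For general exponent `h 1` the outermost step is the nonterminating lemma `hasSum_bailey` with `b =
h 1`, `c = h 2`. It needs `Re(1 + h 0 - h 1 - h 2) > 0`, which follows from the hypotheses when `m ≥
2` but not when `m = 1`. For `m = 1` the integral is a Gauss series, and the very-well-poised series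
is summed by Bailey's lemma with the pair `h 2`, `h 3` instead (Dougall's sum); the two values are
then compared.

The analytic work is absolute convergence: power-law bounds for quotients of rising factorials
justify the interchange of sums, and a lower bound for the nested denominator makes the integral
converge, including the boundary case of the hypothesis on `Re (h 1)` when `m ≥ 2`. -/

namespace VasilyevZudilin

/-! ### Rising factorials and the Chu–Vandermonde sum. -/

/-- The rising factorial `(s)_n`. -/
noncomputable def poch (s : ℂ) (n : ℕ) : ℂ := (ascPochhammer ℂ n).eval s

@[simp] lemma poch_zero (s : ℂ) : poch s 0 = 1 := by simp [poch]

lemma poch_succ (s : ℂ) (n : ℕ) : poch s (n + 1) = poch s n * (s + n) :=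
  ascPochhammer_succ_eval n s

lemma poch_succ_left (s : ℂ) (n : ℕ) : poch s (n + 1) = s * poch (s + 1) n := by
  simp [poch, ascPochhammer_succ_left, Polynomial.eval_comp]

lemma poch_add (s : ℂ) (m n : ℕ) : poch s (m + n) = poch s m * poch (s + m) n := by
  induction n with
  | zero => simp
  | succ n ih => rw [← add_assoc, poch_succ, poch_succ, ih]; push_cast; ring

lemma poch_ne_zero {s : ℂ} (hs : ¬ IsNonposInt s) (n : ℕ) : poch s n ≠ 0 := by
  rw [poch, Ne, ascPochhammer_eval_eq_zero_iff]
  rintro ⟨k, -, hk⟩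
  exact hs ⟨k, by rw [hk, neg_neg]⟩

lemma IsNonposInt.of_add_natCast {s : ℂ} {n : ℕ} (h : IsNonposInt (s + n)) : IsNonposInt s := by
  obtain ⟨k, hk⟩ := h
  exact ⟨k + n, by push_cast; linear_combination hk⟩

lemma not_isNonposInt_of_re_pos {s : ℂ} (hs : 0 < s.re) : ¬ IsNonposInt s := by
  rintro ⟨n, rfl⟩
  simp at hs
  exact absurd hs (not_lt.2 n.cast_nonneg)

lemma add_natCast_ne_zero {s : ℂ} (hs : ¬ IsNonposInt s) (n : ℕ) : s + n ≠ 0 := fun h =>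
  hs ⟨n, eq_neg_of_add_eq_zero_left h⟩

lemma poch_neg_natCast_mul (n k : ℕ) (hk : k ≤ n) :
    poch (-n) k * ((n - k).factorial : ℂ) = (-1) ^ k * n.factorial := by
  induction k with
  | zero => simp
  | succ k ih =>
    have e : n - k = (n - (k + 1)) + 1 := by omega
    have h := ih (by omega)
    rw [e, Nat.factorial_succ, ← e] at h
    rw [poch_succ, pow_succ]
    push_cast [Nat.cast_sub (show k ≤ n by omega)] at h
    linear_combination -h

lemma poch_neg_natCast_eq_zero {n k : ℕ} (hk : n < k) : poch (-n) k = 0 :=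
  ascPochhammer_eval_neg_coe_nat_of_lt hk

lemma factorial_cast_ne_zero (n : ℕ) : (n.factorial : ℂ) ≠ 0 := by exact_mod_cast n.factorial_ne_zero

lemma poch_neg_natCast (n k : ℕ) :
    poch (-n) k = (-1) ^ k * (n.choose k : ℂ) * k.factorial := by
  rcases le_or_gt k n with hk | hk
  · have h := poch_neg_natCast_mul n k hk
    rw [Nat.cast_choose ℂ hk]
    have := factorial_cast_ne_zero k
    have := factorial_cast_ne_zero (n - k)
    field_simp
    exact h
  · rw [poch_neg_natCast_eq_zero hk, Nat.choose_eq_zero_of_lt hk]; simp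

lemma not_isNonposInt_add_one {y : ℂ} (hy : ¬ IsNonposInt y) : ¬ IsNonposInt (y + 1) := fun h =>
  hy (IsNonposInt.of_add_natCast (n := 1) (by simpa using h))

lemma not_isNonposInt_add_natCast {y : ℂ} (hy : ¬ IsNonposInt y) (n : ℕ) :
    ¬ IsNonposInt (y + n) := fun h => hy h.of_add_natCast

/-- The Chu–Vandermonde summation. -/
lemma chu_vandermonde (N : ℕ) (x y : ℂ) (hy : ¬ IsNonposInt y) :
    ∑ j ∈ Finset.range (N + 1), poch (-N) j * poch x j / (j.factorial * poch y j) =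
      poch (y - x) N / poch y N := by
  -- Since `(-N)_j / j! = (-1)^j binom(N, j)`, Pascal's rule writes the sum for `N + 1` as the sum
  -- for `N` minus `x / y` times the sum for `N` at `(x + 1, y + 1)`. Hence the induction over all
  -- `x`, `y` at once.
  have key : ∀ (N : ℕ) (x y : ℂ), ¬ IsNonposInt y →
      ∑ j ∈ Finset.range (N + 1), (-1 : ℂ) ^ j * (N.choose j : ℂ) * (poch x j / poch y j) =
        poch (y - x) N / poch y N := by
    intro N
    induction N with
    | zero => intro x y _; simp
    | succ N ih =>
      intro x y hy
      have hy1 := not_isNonposInt_add_one hy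
      have hy0 : y ≠ 0 := by simpa using add_natCast_ne_zero hy 0
      have e1 : ∀ j ∈ Finset.range (N + 1),
          (-1 : ℂ) ^ (j + 1) * ((N + 1).choose (j + 1) : ℂ) * (poch x (j + 1) / poch y (j + 1)) =
          (-1 : ℂ) ^ (j + 1) * (N.choose (j + 1) : ℂ) * (poch x (j + 1) / poch y (j + 1)) -
          (x / y) * ((-1 : ℂ) ^ j * (N.choose j : ℂ) * (poch (x + 1) j / poch (y + 1) j)) := by
        intro j _
        rw [Nat.choose_succ_succ, poch_succ_left x, poch_succ_left y]
        have := poch_ne_zero hy1 j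
        push_cast
        field_simp
        ring
      have e2 := Finset.sum_range_succ' (fun j => (-1 : ℂ) ^ j * (N.choose j : ℂ) *
        (poch x j / poch y j)) (N + 1)
      rw [Finset.sum_range_succ, ih x y hy] at e2
      simp only [Nat.choose_succ_self] at e2
      rw [Finset.sum_range_succ', Finset.sum_congr rfl e1, Finset.sum_sub_distrib,
        ← Finset.mul_sum, ih _ _ hy1]
      simp only [Nat.choose_zero_right, pow_zero, poch_zero] at e2 ⊢
      have h3 := poch_ne_zero hy N
      have h4 := poch_ne_zero hy1 N
      have h5 := add_natCast_ne_zero hy N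
      have h6 : poch y N * (y + N) = y * poch (y + 1) N := by rw [← poch_succ, poch_succ_left]
      rw [poch_succ, poch_succ, show y + 1 - (x + 1) = y - x by ring]
      have h7 : poch (y + 1) N = poch y N * (y + N) / y := by
        rw [h6]; field_simp
      have e3 : poch (y - x) N * (y - x + N) / (poch y N * (y + N)) =
          poch (y - x) N / poch y N - x / y * (poch (y - x) N / poch (y + 1) N) := by
        rw [h7]; field_simp; ring
      rw [e3]
      linear_combination -e2
  rw [← key N x y hy]
  refine Finset.sum_congr rfl fun j _ => ?_
  rw [poch_neg_natCast]
  have := factorial_cast_ne_zero j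
  have := poch_ne_zero hy j
  field_simp

/-! ### Bailey pairs: the terminating lemma, the unit pair, the very-well-poised pair. -/

/-- The sequence `β` of a Bailey pair relative to `a` (at `q = 1`), in terms of `α`. -/
noncomputable def baileyBeta (a : ℂ) (α : ℕ → ℂ) (k : ℕ) : ℂ :=
  ∑ l ∈ Finset.range (k + 1), α l / ((k - l).factorial * poch (1 + a) (k + l))

/-- This is the coefficient of `α l` in the terminating Bailey lemma after the interchange of sums,
with `k = l + j` and `n = N + l`. Splitting off the first factors of each rising factorial leaves
Chu–Vandermonde with parameters `-N`, `c + l`, `1 + a + 2l`. -/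
lemma bailey_inner_finite {a c : ℂ} (ha : ¬ IsNonposInt (1 + a)) (hc : ¬ IsNonposInt (1 + a - c))
    (N l : ℕ) :
    ∑ j ∈ Finset.range (N + 1), poch (-(N + l : ℕ)) (l + j) * poch c (l + j) /
        (j.factorial * poch (1 + a) (l + j + l)) =
      (N + l).factorial * poch (1 + a - c) (N + l) * ((-1) ^ l * poch c l / poch (1 + a - c) l) /
        (N.factorial * poch (1 + a) (N + l + l)) := by
  have ha2 := not_isNonposInt_add_natCast ha (2 * l)
  have h1 : ∀ j, poch (1 + a) (l + j + l) = poch (1 + a) (2 * l) * poch (1 + a + (2 * l : ℕ)) j :=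
    fun j => by rw [← poch_add]; congr 1; ring
  have h2 := chu_vandermonde N (c + l) (1 + a + (2 * l : ℕ)) ha2
  have h3 : ∀ j ∈ Finset.range (N + 1), poch (-(N + l : ℕ)) (l + j) * poch c (l + j) /
        (j.factorial * poch (1 + a) (l + j + l)) =
      poch (-(N + l : ℕ)) l * poch c l / poch (1 + a) (2 * l) *
        (poch (-N) j * poch (c + l) j / (j.factorial * poch (1 + a + (2 * l : ℕ)) j)) := by
    intro j _
    rw [h1, poch_add c, poch_add (-(N + l : ℕ))]
    have := factorial_cast_ne_zero j
    have := poch_ne_zero ha2 j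
    have := poch_ne_zero ha (2 * l)
    rw [show (-((N + l : ℕ) : ℂ) + l) = -N by push_cast; ring]
    field_simp
  rw [Finset.sum_congr rfl h3, ← Finset.mul_sum, h2]
  have h4 := poch_neg_natCast_mul (N + l) l (by omega)
  rw [Nat.add_sub_cancel] at h4
  have h5 : poch (1 + a - c) (N + l) = poch (1 + a - c) l * poch (1 + a - c + l) N := by
    rw [← poch_add, add_comm l N]
  have h6 : poch (1 + a) (N + l + l) = poch (1 + a) (2 * l) * poch (1 + a + (2 * l : ℕ)) N := by
    rw [← poch_add]; congr 1; ring
  rw [h5, h6, show (1 + a + (2 * l : ℕ) - (c + l)) = 1 + a - c + l by push_cast; ring]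
  have := factorial_cast_ne_zero N
  have := poch_ne_zero ha2 N
  have := poch_ne_zero ha (2 * l)
  have := poch_ne_zero hc l
  field_simp
  linear_combination poch c l * poch (1 + a - c + l) N * h4

/-- Bailey's lemma, terminating case. -/
lemma bailey_finite {a c : ℂ} (ha : ¬ IsNonposInt (1 + a)) (hc : ¬ IsNonposInt (1 + a - c))
    (α : ℕ → ℂ) (n : ℕ) :
    ∑ k ∈ Finset.range (n + 1), poch (-n) k * poch c k * baileyBeta a α k =
      n.factorial * poch (1 + a - c) n *
        baileyBeta a (fun l => (-1) ^ l * poch c l / poch (1 + a - c) l * α l) n := by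
  simp only [baileyBeta, Finset.mul_sum]
  -- Interchange over the triangle `l ≤ k ≤ n`.
  rw [Finset.sum_comm' (t' := Finset.range (n + 1)) (s' := fun l => Finset.Ico l (n + 1))
    (by intro x y; simp only [Finset.mem_range, Finset.mem_Ico]; omega)]
  refine Finset.sum_congr rfl fun l hl => ?_
  obtain ⟨N, rfl⟩ : ∃ N, n = N + l := ⟨n - l, by have := Finset.mem_range.1 hl; omega⟩
  rw [Finset.sum_Ico_eq_sum_range, show N + l + 1 - l = N + 1 by omega]
  have h := bailey_inner_finite ha hc N l
  have e : ∀ j ∈ Finset.range (N + 1), poch (-(N + l : ℕ)) (l + j) * poch c (l + j) *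
      (α l / (((l + j - l).factorial : ℂ) * poch (1 + a) (l + j + l))) =
      α l * (poch (-(N + l : ℕ)) (l + j) * poch c (l + j) /
        (j.factorial * poch (1 + a) (l + j + l))) := by
    intro j _
    rw [Nat.add_sub_cancel_left]; ring
  rw [Finset.sum_congr rfl e, ← Finset.mul_sum, h, Nat.add_sub_cancel]
  ring

/-- The very-well-poised factor `(a)_l (a/2 + 1)_l / (l! (a/2)_l)`. -/
noncomputable def vwp (a : ℂ) (l : ℕ) : ℂ :=
  poch a l * poch (a / 2 + 1) l / (l.factorial * poch (a / 2) l)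

lemma not_isNonposInt_of_one_add {a : ℂ} (h0 : a ≠ 0) (ha : ¬ IsNonposInt (1 + a)) :
    ¬ IsNonposInt a := by
  rintro ⟨n, rfl⟩
  rcases n with _ | n
  · simp at h0
  · exact ha ⟨n, by push_cast; ring⟩

lemma not_isNonposInt_half {a : ℂ} (ha : ¬ IsNonposInt a) : ¬ IsNonposInt (a / 2) := by
  rintro ⟨n, hn⟩
  exact ha ⟨2 * n, by push_cast; linear_combination 2 * hn⟩

/-- The half parameters collapse, `(a/2 + 1)_l / (a/2)_l = (a + 2l) / a`, so that later identities
are rational in `a` and `l` apart from one family of rising factorials. -/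
lemma vwp_eq {a : ℂ} (ha : ¬ IsNonposInt a) (l : ℕ) :
    vwp a l = poch (1 + a) l * (a + 2 * l) / ((a + l) * l.factorial) := by
  have h2 := not_isNonposInt_half ha
  have e1 : poch (a / 2) l * (a / 2 + l) = a / 2 * poch (a / 2 + 1) l := by
    rw [← poch_succ, poch_succ_left]
  have e2 : poch a l * (a + l) = a * poch (1 + a) l := by
    rw [← poch_succ, poch_succ_left, add_comm]
  have := add_natCast_ne_zero ha l
  have ha0 : a ≠ 0 := by simpa using add_natCast_ne_zero ha 0
  have := poch_ne_zero h2 l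
  have := factorial_cast_ne_zero l
  have e3 : poch (a / 2 + 1) l = poch (a / 2) l * (a + 2 * l) / a := by
    rw [eq_div_iff ha0]; linear_combination -2 * e1
  have e4 : poch (1 + a) l = poch a l * (a + l) / a := by
    rw [eq_div_iff ha0]; linear_combination -e2
  rw [vwp, e3, e4]
  field_simp

/-- The partial sums of the unit-pair sum have a closed product form, which makes an induction
possible. The total index `L + 1 + d` stays fixed while `L` grows, so the step uses the hypothesis
at `d + 1`. -/
lemma unit_bailey_partial {a : ℂ} (h0 : a ≠ 0) (ha : ¬ IsNonposInt (1 + a)) (L d : ℕ) :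
    ∑ l ∈ Finset.range (L + 1), (-1) ^ l * vwp a l /
        ((L + 1 + d - l).factorial * poch (1 + a) (L + 1 + d + l)) =
      (-1) ^ L * poch (1 + a) L /
        (L.factorial * d.factorial * (L + 1 + d) * poch (1 + a) (L + 1 + d + L)) := by
  have ha' := not_isNonposInt_of_one_add h0 ha
  have hd : ∀ n : ℕ, (n : ℂ) + 1 ≠ 0 := fun n => by exact_mod_cast n.succ_ne_zero
  induction L generalizing d with
  | zero =>
    have := factorial_cast_ne_zero d
    have := hd d
    simp only [zero_add, Finset.sum_range_one, vwp_eq ha']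
    simp only [Nat.sub_zero, add_comm 1 d, Nat.factorial_succ]
    push_cast
    simp only [poch_zero, Nat.factorial_zero]
    have := poch_ne_zero ha (d + 1)
    simp only [add_zero, mul_zero, pow_zero, Nat.cast_one, zero_add, add_comm 1 (d : ℂ), one_mul,
      mul_one]
    field_simp
  | succ L ih =>
    rw [Finset.sum_range_succ, show L + 1 + 1 + d = L + 1 + (d + 1) by ring, ih (d + 1), vwp_eq ha']
    have e1 : L + 1 + (d + 1) - (L + 1) = d + 1 := by omega
    have e2 : L + 1 + (d + 1) + (L + 1) = (L + 1 + (d + 1) + L) + 1 := by ring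
    rw [e1, e2, poch_succ (1 + a) L, poch_succ (1 + a) (L + 1 + (d + 1) + L), Nat.factorial_succ,
      Nat.factorial_succ L]
    have n1 := factorial_cast_ne_zero d
    have n2 := factorial_cast_ne_zero L
    have n3 := poch_ne_zero ha (L + 1 + (d + 1) + L)
    have n4 := add_natCast_ne_zero ha (L + 1 + (d + 1) + L)
    have n5 := add_natCast_ne_zero ha' (L + 1)
    have n6 := hd d
    have n7 := hd L
    have n8 := hd (L + 1 + d)
    push_cast at *
    have n9 : (L : ℂ) + 1 + (d + 1) ≠ 0 := by convert n8 using 1; ring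
    have n10 : (L : ℂ) + 1 + 1 + d ≠ 0 := by convert n8 using 1; ring
    field_simp
    ring

/-- The unit Bailey pair. -/
lemma unit_bailey {a : ℂ} (h0 : a ≠ 0) (ha : ¬ IsNonposInt (1 + a)) (k : ℕ) :
    baileyBeta a (fun l => (-1) ^ l * vwp a l) k = if k = 0 then 1 else 0 := by
  have ha' := not_isNonposInt_of_one_add h0 ha
  rcases k with _ | k
  · simp [baileyBeta, vwp]
  · rw [if_neg (Nat.succ_ne_zero k), baileyBeta, Finset.sum_range_succ]
    -- At `d = 0` only the term `l = k + 1` is missing, and it cancels the partial sum.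
    have h := unit_bailey_partial h0 ha k 0
    simp only [add_zero] at h
    rw [h, vwp_eq ha', Nat.sub_self, show k + 1 + (k + 1) = k + 1 + k + 1 by ring, poch_succ _ k,
      poch_succ _ (k + 1 + k), Nat.factorial_succ]
    have n1 := factorial_cast_ne_zero k
    have n2 := poch_ne_zero ha (k + 1 + k)
    have n3 := add_natCast_ne_zero ha (k + 1 + k)
    have n4 := add_natCast_ne_zero ha' (k + 1)
    have n5 : (k : ℂ) + 1 ≠ 0 := by exact_mod_cast k.succ_ne_zero
    push_cast at *
    have n6 := poch_ne_zero ha (k + 1)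
    simp only [Nat.factorial_zero, Nat.cast_one, mul_one, one_mul]
    field_simp
    ring

/-- The very-well-poised `α`-sequence with parameters `c 0, …, c m`. -/
noncomputable def vwpAlpha (a : ℂ) (c : ℕ → ℂ) (m l : ℕ) : ℂ :=
  (-1) ^ (m * l) * vwp a l *
    ∏ i ∈ Finset.range (m + 1), poch (c i) l / poch (1 + a - c i) l

/-- One application of the terminating lemma to the unit pair: only `k = 0` survives on the left,
and the two signs `(-1)^l` cancel. This is the base case of the induction on dimension. -/
lemma baileyBeta_vwpAlpha_zero {a : ℂ} {c : ℕ → ℂ} (h0 : a ≠ 0) (ha : ¬ IsNonposInt (1 + a))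
    (hc : ¬ IsNonposInt (1 + a - c 0)) (n : ℕ) :
    n.factorial * poch (1 + a - c 0) n * baileyBeta a (vwpAlpha a c 0) n = 1 := by
  have h := bailey_finite ha hc (fun l => (-1) ^ l * vwp a l) n
  simp only [unit_bailey h0 ha] at h
  rw [Finset.sum_range_succ'] at h
  simp only [Nat.succ_ne_zero, if_false, mul_zero, Finset.sum_const_zero, if_true, poch_zero,
    zero_add, mul_one] at h
  refine Eq.trans ?_ h.symm
  congr 2
  funext l
  simp only [vwpAlpha, zero_mul, pow_zero, zero_add, Finset.prod_range_one]
  have : ((-1 : ℂ)) ^ l * (-1) ^ l = 1 := by rw [← mul_pow]; simp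
  linear_combination -(poch (c 0) l / poch (1 + a - c 0) l * vwp a l) * this

/-- The factor split off is the one created by `bailey_finite`, so each dimension costs one
application of Bailey's lemma. -/
lemma vwpAlpha_succ (a : ℂ) (c : ℕ → ℂ) (m l : ℕ) :
    vwpAlpha a c (m + 1) l =
      (-1) ^ l * poch (c 0) l / poch (1 + a - c 0) l * vwpAlpha a (fun i => c (i + 1)) m l := by
  rw [vwpAlpha, vwpAlpha, Finset.prod_range_succ' _ (m + 1), add_mul, pow_add, one_mul]
  ring

end VasilyevZudilin

/-! ### Euler's limit and power-law growth of rising factorials. -/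

namespace VasilyevZudilin
open Filter Topology

lemma poch_eq_prod (s : ℂ) (n : ℕ) : poch s n = ∏ j ∈ Finset.range n, (s + j) := by
  induction n with
  | zero => simp
  | succ n ih => rw [poch_succ, Finset.prod_range_succ, ih]

lemma cast_add_one_cpow_ne_zero (n : ℕ) (s : ℂ) : ((n : ℂ) + 1) ^ s ≠ 0 := by
  rw [Ne, Complex.cpow_eq_zero_iff]
  rintro ⟨h, -⟩
  exact n.succ_ne_zero (by exact_mod_cast h)

/-- Euler's limit: `(s)_n / (n! (n + 1)^(s - 1))` tends to `1 / Γ(s)`. -/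
lemma tendsto_poch_div (s : ℂ) :
    Tendsto (fun n : ℕ => poch s n / (n.factorial * ((n : ℂ) + 1) ^ (s - 1))) atTop
      (𝓝 (Complex.Gamma s)⁻¹) := by
  by_cases hs : IsNonposInt s
  -- At a pole `Complex.Gamma` has the value 0, so the claimed limit is 0; and `(s)_n` vanishes for
  -- large `n`.
  · have hG : Complex.Gamma s = 0 := (Complex.Gamma_eq_zero_iff s).2 hs
    rw [hG, inv_zero]
    obtain ⟨m, rfl⟩ := hs
    refine tendsto_const_nhds.congr' ?_
    filter_upwards [eventually_gt_atTop m] with n hn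
    rw [poch_neg_natCast_eq_zero hn, zero_div]
  · have hG : Complex.Gamma s ≠ 0 := fun h => hs ((Complex.Gamma_eq_zero_iff s).1 h)
    have h1 := (Complex.GammaSeq_tendsto_Gamma s).inv₀ hG
    have h2 : Tendsto (fun n : ℕ => ((n : ℝ) / (n + 1))) atTop (𝓝 1) :=
      tendsto_natCast_div_add_atTop 1
    have h3 : Tendsto (fun n : ℕ => (((n : ℝ) / (n + 1) : ℝ) : ℂ) ^ (s - 1)) atTop (𝓝 1) := by
      have h := (continuousAt_cpow_const (b := s - 1) (a := 1) (by simp)).tendsto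
      rw [Complex.one_cpow] at h
      refine h.comp ?_
      have := (Complex.continuous_ofReal.tendsto 1).comp h2
      simpa [Function.comp_def] using this
    have h4 : Tendsto (fun n : ℕ => (n : ℂ) / (n + s)) atTop (𝓝 1) :=
      tendsto_natCast_div_add_atTop s
    have h5 := (h1.mul h3).mul h4
    rw [mul_one, mul_one] at h5
    refine h5.congr' ?_
    filter_upwards [eventually_gt_atTop 0] with n hn
    have hn0 : (n : ℂ) ≠ 0 := by exact_mod_cast hn.ne'
    rw [Complex.GammaSeq, ← poch_eq_prod, poch_succ]
    have e : ((n : ℂ) + 1) = (((n : ℝ) + 1 : ℝ) : ℂ) := by push_cast; rfl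
    have e3 : (((n : ℝ) / (n + 1) : ℝ) : ℂ) ^ (s - 1) = (n : ℂ) ^ (s - 1) / ((n : ℂ) + 1) ^ (s - 1) := by
      rw [e, eq_div_iff (by rw [← e]; exact cast_add_one_cpow_ne_zero n _),
        ← Complex.mul_cpow_ofReal_nonneg (by positivity) (by positivity), ← Complex.ofReal_mul,
        div_mul_cancel₀ _ (by positivity)]
      simp
    rw [e3, Complex.cpow_sub _ _ hn0, Complex.cpow_one]
    have n1 := add_natCast_ne_zero hs n
    have n2 := poch_ne_zero hs n
    have n3 := factorial_cast_ne_zero n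
    have n4 := cast_add_one_cpow_ne_zero n (s - 1)
    have n5 : (n : ℂ) ^ s ≠ 0 := by rw [Ne, Complex.cpow_eq_zero_iff]; tauto
    rw [add_comm (n : ℂ) s]
    field_simp

/-- `f n = O((n + 1)^e)`. -/
def PolyBound (f : ℕ → ℂ) (e : ℝ) : Prop := ∃ C : ℝ, 0 < C ∧ ∀ n : ℕ, ‖f n‖ ≤ C * ((n : ℝ) + 1) ^ e

lemma PolyBound.mul {f g : ℕ → ℂ} {e e' : ℝ} (hf : PolyBound f e) (hg : PolyBound g e') :
    PolyBound (fun n => f n * g n) (e + e') := by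
  obtain ⟨C, hC, h⟩ := hf
  obtain ⟨C', hC', h'⟩ := hg
  refine ⟨C * C', by positivity, fun n => ?_⟩
  rw [norm_mul, Real.rpow_add (by positivity)]
  calc ‖f n‖ * ‖g n‖ ≤ (C * ((n : ℝ) + 1) ^ e) * (C' * ((n : ℝ) + 1) ^ e') := by
        gcongr
        · exact h n
        · exact h' n
    _ = _ := by ring

lemma PolyBound.one : PolyBound (fun _ => 1) 0 := ⟨1, one_pos, fun n => by simp⟩

lemma PolyBound.prod {ι : Type*} (t : Finset ι) {f : ι → ℕ → ℂ} {e : ι → ℝ}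
    (h : ∀ i ∈ t, PolyBound (f i) (e i)) :
    PolyBound (fun n => ∏ i ∈ t, f i n) (∑ i ∈ t, e i) := by
  classical
  induction t using Finset.induction_on with
  | empty => simpa using PolyBound.one
  | insert a t ha ih =>
    simp only [Finset.prod_insert ha, Finset.sum_insert ha]
    exact (h a (Finset.mem_insert_self a t)).mul
      (ih fun i hi => h i (Finset.mem_insert_of_mem hi))

lemma PolyBound.congr_norm {f g : ℕ → ℂ} {e : ℝ} (hf : PolyBound f e) (h : ∀ n, ‖g n‖ = ‖f n‖) :
    PolyBound g e := by
  obtain ⟨C, hC, hb⟩ := hf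
  exact ⟨C, hC, fun n => by rw [h]; exact hb n⟩

lemma summable_add_one_rpow {e : ℝ} (he : e < -1) : Summable fun n : ℕ => ((n : ℝ) + 1) ^ e := by
  have := (summable_nat_add_iff 1).2 (Real.summable_nat_rpow.2 he)
  simpa using this

lemma PolyBound.summable_norm {f : ℕ → ℂ} {e : ℝ} (hf : PolyBound f e) (he : e < -1) :
    Summable fun n => ‖f n‖ := by
  obtain ⟨C, hC, h⟩ := hf
  exact Summable.of_nonneg_of_le (fun n => norm_nonneg _) h ((summable_add_one_rpow he).mul_left C)

lemma PolyBound.summable {f : ℕ → ℂ} {e : ℝ} (hf : PolyBound f e) (he : e < -1) : Summable f :=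
  (hf.summable_norm he).of_norm

lemma PolyBound.tendsto_zero {f : ℕ → ℂ} {e : ℝ} (hf : PolyBound f e) (he : e < 0) :
    Tendsto f atTop (𝓝 0) := by
  obtain ⟨C, hC, h⟩ := hf
  refine squeeze_zero_norm h ?_
  have h1 : Tendsto (fun n : ℕ => ((n : ℝ) + 1) ^ e) atTop (𝓝 0) := by
    have := (tendsto_rpow_neg_atTop (neg_pos.2 he)).comp
      (tendsto_atTop_add_const_right atTop (1 : ℝ) tendsto_natCast_atTop_atTop)
    simpa [Function.comp_def] using this
  simpa using h1.const_mul C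

lemma PolyBound.of_tendsto {f w : ℕ → ℂ} {e : ℝ} {x : ℂ} (h : Tendsto (fun n => f n / w n) atTop (𝓝 x))
    (hw0 : ∀ n, w n ≠ 0) (hw : ∀ n : ℕ, ‖w n‖ = ((n : ℝ) + 1) ^ e) : PolyBound f e := by
  obtain ⟨C, hC⟩ := h.norm.bddAbove_range
  refine ⟨max C 1, by positivity, fun n => ?_⟩
  have := hC ⟨n, rfl⟩
  rw [← hw, ← div_le_iff₀ (norm_pos_iff.2 (hw0 n)), ← norm_div]
  exact this.trans (le_max_left _ _)

lemma norm_cast_add_one_cpow (n : ℕ) (s : ℂ) : ‖((n : ℂ) + 1) ^ s‖ = ((n : ℝ) + 1) ^ s.re := by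
  have e : ((n : ℂ) + 1) = (((n : ℝ) + 1 : ℝ) : ℂ) := by push_cast; rfl
  rw [e, Complex.norm_cpow_eq_rpow_re_of_pos (by positivity)]

lemma polyBound_cast : PolyBound (fun n => (n : ℂ)) 1 :=
  ⟨1, one_pos, fun n => by simp⟩

lemma polyBound_poch_div_factorial (s : ℂ) :
    PolyBound (fun n => poch s n / n.factorial) (s.re - 1) := by
  refine PolyBound.of_tendsto (w := fun n => ((n : ℂ) + 1) ^ (s - 1)) (x := (Complex.Gamma s)⁻¹) ?_
    (fun n => cast_add_one_cpow_ne_zero n _) (fun n => by rw [norm_cast_add_one_cpow]; simp)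
  refine (tendsto_poch_div s).congr fun n => ?_
  rw [div_div]

lemma polyBound_factorial_div_poch {s : ℂ} (hs : ¬ IsNonposInt s) :
    PolyBound (fun n => n.factorial / poch s n) (1 - s.re) := by
  have hG : Complex.Gamma s ≠ 0 := fun h => hs ((Complex.Gamma_eq_zero_iff s).1 h)
  refine PolyBound.of_tendsto (w := fun n => ((n : ℂ) + 1) ^ (1 - s))
    (x := (Complex.Gamma s)⁻¹⁻¹) ?_
    (fun n => cast_add_one_cpow_ne_zero n _) (fun n => by rw [norm_cast_add_one_cpow]; simp)
  refine ((tendsto_poch_div s).inv₀ (inv_ne_zero hG)).congr fun n => ?_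
  rw [← neg_sub s 1, Complex.cpow_neg, inv_div, div_inv_eq_mul, div_mul_eq_mul_div]

lemma polyBound_poch_div_poch (s : ℂ) {t : ℂ} (ht : ¬ IsNonposInt t) :
    PolyBound (fun n => poch s n / poch t n) (s.re - t.re) := by
  have h := (polyBound_poch_div_factorial s).mul (polyBound_factorial_div_poch ht)
  have e : s.re - 1 + (1 - t.re) = s.re - t.re := by ring
  rw [e] at h
  refine h.congr_norm fun n => ?_
  congr 1
  have := factorial_cast_ne_zero n
  field_simp

/-! ### Gauss's summation theorem. -/

/-- The terms of the series `₂F₁(a, b; c; 1)`. -/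
noncomputable def gaussTerm (a b c : ℂ) (k : ℕ) : ℂ := poch a k * poch b k / (k.factorial * poch c k)

lemma polyBound_gaussTerm (a b : ℂ) {c : ℂ} (hc : ¬ IsNonposInt c) :
    PolyBound (gaussTerm a b c) ((a + b - c).re - 1) := by
  have h := (polyBound_poch_div_factorial a).mul (polyBound_poch_div_poch b hc)
  have e : a.re - 1 + (b.re - c.re) = (a + b - c).re - 1 := by simp; ring
  rw [e] at h
  refine h.congr_norm fun n => ?_
  rw [gaussTerm, mul_div_mul_comm]

lemma summable_norm_gaussTerm {a b c : ℂ} (hc : ¬ IsNonposInt c) (h : 0 < (c - a - b).re) :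
    Summable fun k => ‖gaussTerm a b c k‖ :=
  (polyBound_gaussTerm a b hc).summable_norm (by simp at h ⊢; linarith)

/-- With `t_k` the terms at `c`, the termwise difference of the two sides is `c (k t_k - (k+1)
t_{k+1})`. It telescopes, and `k t_k` tends to 0 because its growth exponent is `Re(a + b - c) < 0`.
-/
lemma gauss_contiguous {a b c : ℂ} (hc : ¬ IsNonposInt c) (h : 0 < (c - a - b).re) :
    c * (c - a - b) * ∑' k, gaussTerm a b c k =
      (c - a) * (c - b) * ∑' k, gaussTerm a b (c + 1) k := by
  have hc1 := not_isNonposInt_add_one hc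
  have hc0 : c ≠ 0 := by simpa using add_natCast_ne_zero hc 0
  have s1 := (summable_norm_gaussTerm hc h).of_norm
  have s2 := (summable_norm_gaussTerm (a := a) (b := b) hc1 (by simp at h ⊢; linarith)).of_norm
  have key : ∀ k : ℕ, c * (c - a - b) * gaussTerm a b c k -
      (c - a) * (c - b) * gaussTerm a b (c + 1) k =
      c * (k * gaussTerm a b c k) - c * ((k + 1 : ℕ) * gaussTerm a b c (k + 1)) := by
    intro k
    have e : poch (c + 1) k = poch c k * (c + k) / c := by
      rw [eq_div_iff hc0, ← poch_succ, poch_succ_left]; ring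
    rw [gaussTerm, gaussTerm, gaussTerm, e, poch_succ, poch_succ, poch_succ, Nat.factorial_succ]
    have := poch_ne_zero hc k
    have := add_natCast_ne_zero hc k
    have := factorial_cast_ne_zero k
    have : (k : ℂ) + 1 ≠ 0 := by exact_mod_cast k.succ_ne_zero
    push_cast
    field_simp
    ring
  have hs := ((s1.hasSum.mul_left (c * (c - a - b))).sub
    (s2.hasSum.mul_left ((c - a) * (c - b)))).tendsto_sum_nat
  simp only [key] at hs
  simp only [Finset.sum_range_sub'
    (fun k : ℕ => c * ((k : ℂ) * gaussTerm a b c k))] at hs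
  have hz : Tendsto (fun k : ℕ => (k : ℂ) * gaussTerm a b c k) atTop (𝓝 0) :=
    (polyBound_cast.mul (polyBound_gaussTerm a b hc)).tendsto_zero (by simp at h ⊢; linarith)
  have h3 := (hz.const_mul c).const_sub (c * (((0 : ℕ) : ℂ) * gaussTerm a b c 0))
  have h4 := tendsto_nhds_unique hs h3
  simp only [Nat.cast_zero, zero_mul, mul_zero, sub_zero] at h4
  linear_combination h4

lemma gauss_iterate {a b c : ℂ} (hc : ¬ IsNonposInt c) (h : 0 < (c - a - b).re) (N : ℕ) :
    poch c N * poch (c - a - b) N * ∑' k, gaussTerm a b c k =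
      poch (c - a) N * poch (c - b) N * ∑' k, gaussTerm a b (c + N) k := by
  induction N with
  | zero => simp
  | succ N ih =>
    have h1 := gauss_contiguous (a := a) (b := b) (not_isNonposInt_add_natCast hc N)
      (by simp at h ⊢; have : (0 : ℝ) ≤ N := N.cast_nonneg; linarith)
    simp only [poch_succ]
    push_cast
    rw [← add_assoc]
    linear_combination (c + N) * (c - a - b + N) * ih + poch (c - a) N * poch (c - b) N * h1

/-- For real positive `s` each factor satisfies `s + i ≤ Re t + i ≤ |t + i|`. It serves to replace
complex denominators by real ones in majorants. -/
lemma norm_poch_mono {s t : ℂ} (hs : 0 < s.re) (him : s.im = 0) (hst : s.re ≤ t.re) (n : ℕ) :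
    ‖poch s n‖ ≤ ‖poch t n‖ := by
  rw [poch_eq_prod, poch_eq_prod, norm_prod, norm_prod]
  refine Finset.prod_le_prod (fun i _ => norm_nonneg _) fun i _ => ?_
  have h1 : ‖s + i‖ = s.re + i := by
    have : s + i = ((s.re + i : ℝ) : ℂ) := by
      apply Complex.ext <;> simp [him]
    rw [this, Complex.norm_real, Real.norm_of_nonneg (by positivity)]
  rw [h1]
  calc s.re + i ≤ t.re + i := by gcongr
    _ = (t + i).re := by simp
    _ ≤ ‖t + i‖ := Complex.re_le_norm _

/-- Every term with `k ≥ 1` tends to 0 as the lower parameter grows. The series with real lower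
parameter `Re c + N₀` dominates once `N ≥ N₀`. -/
lemma tendsto_gauss_shift {a b c : ℂ} (h : 0 < (c - a - b).re) :
    Tendsto (fun N : ℕ => ∑' k, gaussTerm a b (c + N) k) atTop (𝓝 1) := by
  obtain ⟨N₀, hN₀⟩ := exists_nat_gt (-c.re)
  have e1 : (1 : ℂ) = ∑' k, if k = 0 then (1 : ℂ) else 0 := (tsum_ite_eq 0 (fun _ => (1 : ℂ))).symm
  have hpos : 0 < (((c.re + N₀ : ℝ) : ℂ)).re := by simp; linarith
  have hnp := not_isNonposInt_of_re_pos hpos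
  rw [e1]
  refine tendsto_tsum_of_dominated_convergence
    (bound := fun k => ‖gaussTerm a b ((c.re + N₀ : ℝ) : ℂ) k‖)
    (summable_norm_gaussTerm hnp ?_) ?_ ?_
  · simp at h ⊢
    have : (0 : ℝ) ≤ N₀ := N₀.cast_nonneg
    linarith
  · intro k
    rcases k with _ | k
    · simp [gaussTerm]
    · simp only [Nat.succ_ne_zero, if_false]
      have h2 : Tendsto (fun N : ℕ => ‖poch (c + N) (k + 1)‖) atTop atTop := by
        simp only [poch_eq_prod, Finset.prod_range_succ', norm_mul]
        have h1 : Tendsto (fun N : ℕ => ‖c + N + ((0 : ℕ) : ℂ)‖) atTop atTop := by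
          refine tendsto_atTop_mono (f := fun N : ℕ => c.re + (N : ℝ)) (fun N => ?_)
            (tendsto_atTop_add_const_left _ _ tendsto_natCast_atTop_atTop)
          exact le_of_eq_of_le (by simp) (Complex.re_le_norm _)
        refine tendsto_atTop_mono' _ ?_ h1
        obtain ⟨N₁, hN₁⟩ := exists_nat_gt (1 - c.re)
        filter_upwards [eventually_ge_atTop N₁] with N hN
        refine le_mul_of_one_le_left (norm_nonneg _) ?_
        rw [norm_prod]
        rw [← Finset.prod_const_one (ι := ℕ) (s := Finset.range k)]
        refine Finset.prod_le_prod (fun _ _ => zero_le_one) fun i _ => ?_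
        refine le_trans ?_ (Complex.re_le_norm _)
        have : (N₁ : ℝ) ≤ N := by exact_mod_cast hN
        simp
        have : (0 : ℝ) ≤ i := i.cast_nonneg
        linarith
      rw [tendsto_zero_iff_norm_tendsto_zero]
      have h3 : ∀ N : ℕ, ‖gaussTerm a b (c + N) (k + 1)‖ =
          ‖poch a (k + 1) * poch b (k + 1) / ((k + 1).factorial : ℂ)‖ / ‖poch (c + N) (k + 1)‖ := by
        intro N
        rw [gaussTerm, ← norm_div, div_div]
      simp only [h3]
      exact h2.const_div_atTop _
  · filter_upwards [eventually_ge_atTop N₀] with N hN k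
    have hN' : (N₀ : ℝ) ≤ N := by exact_mod_cast hN
    rw [gaussTerm, gaussTerm, norm_div, norm_div, norm_mul (k.factorial : ℂ),
      norm_mul (k.factorial : ℂ)]
    have hk := factorial_cast_ne_zero k
    have hp := norm_pos_iff.2 (poch_ne_zero hnp k)
    have hk' := norm_pos_iff.2 hk
    gcongr
    exact norm_poch_mono hpos (Complex.ofReal_im _) (by simpa using hN') k

/-- Gauss's summation theorem. -/
theorem hasSum_gaussTerm {a b c : ℂ} (hc : ¬ IsNonposInt c) (h : 0 < (c - a - b).re) :
    HasSum (gaussTerm a b c) (Complex.Gamma c * Complex.Gamma (c - a - b) /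
      (Complex.Gamma (c - a) * Complex.Gamma (c - b))) := by
  have hs := (summable_norm_gaussTerm hc h).of_norm
  suffices H : ∑' k, gaussTerm a b c k = Complex.Gamma c * Complex.Gamma (c - a - b) /
      (Complex.Gamma (c - a) * Complex.Gamma (c - b)) from H ▸ hs.hasSum
  have hcab := not_isNonposInt_of_re_pos h
  have hG : ∀ {s : ℂ}, ¬ IsNonposInt s → Complex.Gamma s ≠ 0 := fun hs h =>
    hs ((Complex.Gamma_eq_zero_iff _).1 h)
  -- After `N` contiguous steps the sum is a quotient of four rising factorials times a series
  -- tending to 1. In Euler's limit the factorials and the powers of `N + 1` cancel, since both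
  -- pairs of exponents add up to `2c - a - b - 2`.
  have lim := ((((tendsto_poch_div (c - a)).mul (tendsto_poch_div (c - b))).div
    ((tendsto_poch_div c).mul (tendsto_poch_div (c - a - b)))
    (mul_ne_zero (inv_ne_zero (hG hc)) (inv_ne_zero (hG hcab))))).mul (tendsto_gauss_shift h)
  have lim2 : Tendsto (fun _ : ℕ => ∑' k, gaussTerm a b c k) atTop
      (𝓝 (∑' k, gaussTerm a b c k)) := tendsto_const_nhds
  have := tendsto_nhds_unique (lim2.congr fun N => ?_) lim
  · rw [this]
    have := hG hc
    have := hG hcab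
    simp only [div_eq_mul_inv, mul_inv, inv_inv]
    ring
  · have hi := gauss_iterate hc h N
    have n1 := poch_ne_zero hc N
    have n2 := poch_ne_zero hcab N
    have n3 := factorial_cast_ne_zero N
    have hN : (N : ℂ) + 1 ≠ 0 := by exact_mod_cast N.succ_ne_zero
    have m1 := cast_add_one_cpow_ne_zero N (c - 1)
    have m2 := cast_add_one_cpow_ne_zero N (c - a - b - 1)
    have m3 := cast_add_one_cpow_ne_zero N (c - a - 1)
    have m4 := cast_add_one_cpow_ne_zero N (c - b - 1)
    have e : ((N : ℂ) + 1) ^ (c - 1) * ((N : ℂ) + 1) ^ (c - a - b - 1) =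
        ((N : ℂ) + 1) ^ (c - a - 1) * ((N : ℂ) + 1) ^ (c - b - 1) := by
      rw [← Complex.cpow_add _ _ hN, ← Complex.cpow_add _ _ hN]
      congr 1; ring
    simp only [Pi.div_apply]
    generalize ((N : ℂ) + 1) ^ (c - 1) = w1 at *
    generalize ((N : ℂ) + 1) ^ (c - a - b - 1) = w2 at *
    generalize ((N : ℂ) + 1) ^ (c - a - 1) = w3 at *
    generalize ((N : ℂ) + 1) ^ (c - b - 1) = w4 at *
    have e5 : poch (c - a) N / (N.factorial * w3) * (poch (c - b) N / (N.factorial * w4)) /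
        (poch c N / (N.factorial * w1) * (poch (c - a - b) N / (N.factorial * w2))) =
        poch (c - a) N * poch (c - b) N / (poch c N * poch (c - a - b) N) := by
      rw [div_mul_div_comm, div_mul_div_comm, div_div_div_eq]
      rw [div_eq_div_iff (by positivity) (by positivity)]
      linear_combination poch (c - a) N * poch (c - b) N * poch c N * poch (c - a - b) N * N.factorial ^ 2 * e
    rw [e5, div_mul_eq_mul_div, eq_div_iff (mul_ne_zero n1 n2)]
    linear_combination hi

end VasilyevZudilin

/-! ### The nonterminating Bailey lemma. -/

namespace VasilyevZudilin
open Filter Topology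

lemma Gamma_add_natCast {s : ℂ} (hs : ¬ IsNonposInt s) (n : ℕ) :
    Complex.Gamma (s + n) = poch s n * Complex.Gamma s := by
  have hG : Complex.Gamma s ≠ 0 := fun h => hs ((Complex.Gamma_eq_zero_iff s).1 h)
  rw [poch, ← Complex.Gamma_add_nat_div_Gamma_eq s (fun k hk => hs ⟨k, hk⟩), div_mul_cancel₀ _ hG]

lemma Gamma_ne_zero_of_not_isNonposInt {s : ℂ} (hs : ¬ IsNonposInt s) : Complex.Gamma s ≠ 0 :=
  fun h => hs ((Complex.Gamma_eq_zero_iff s).1 h)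

/-- The kernel of Bailey's lemma. -/
noncomputable def baileyKernel (a b c : ℂ) (l j : ℕ) : ℂ :=
  poch b (l + j) * poch c (l + j) / (j.factorial * poch (1 + a) (2 * l + j))

/-- For fixed `l` the kernel is a Gauss series whose excess is still `1 + a - b - c`, so one
convergence condition serves all `l`. -/
lemma baileyKernel_eq (a b c : ℂ) (l j : ℕ) :
    baileyKernel a b c l j = poch b l * poch c l / poch (1 + a) (2 * l) *
      gaussTerm (b + l) (c + l) (1 + a + (2 * l : ℕ)) j := by
  rw [baileyKernel, gaussTerm, poch_add, poch_add, poch_add, div_mul_div_comm]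
  ring

lemma summable_norm_baileyKernel {a b c : ℂ} (ha : ¬ IsNonposInt (1 + a))
    (h : 0 < (1 + a - b - c).re) (l : ℕ) : Summable fun j => ‖baileyKernel a b c l j‖ := by
  simp only [baileyKernel_eq, norm_mul]
  refine (summable_norm_gaussTerm (not_isNonposInt_add_natCast ha _) ?_).mul_left _
  convert h using 2
  push_cast; ring

lemma hasSum_baileyKernel {a b c : ℂ} (ha : ¬ IsNonposInt (1 + a))
    (hb : ¬ IsNonposInt (1 + a - b)) (hc : ¬ IsNonposInt (1 + a - c))
    (h : 0 < (1 + a - b - c).re) (l : ℕ) :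
    HasSum (baileyKernel a b c l)
      (Complex.Gamma (1 + a) * Complex.Gamma (1 + a - b - c) /
        (Complex.Gamma (1 + a - b) * Complex.Gamma (1 + a - c)) *
        (poch b l / poch (1 + a - b) l * (poch c l / poch (1 + a - c) l))) := by
  have e1 : 1 + a + (2 * l : ℕ) - (b + l) - (c + l) = 1 + a - b - c := by push_cast; ring
  have e2 : 1 + a + (2 * l : ℕ) - (b + l) = 1 + a - b + l := by push_cast; ring
  have e3 : 1 + a + (2 * l : ℕ) - (c + l) = 1 + a - c + l := by push_cast; ring
  have hs := (hasSum_gaussTerm (a := b + l) (b := c + l) (not_isNonposInt_add_natCast ha (2 * l))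
    (by rw [e1]; exact h)).mul_left (poch b l * poch c l / poch (1 + a) (2 * l))
  simp only [← baileyKernel_eq] at hs
  rw [e1, e2, e3, Gamma_add_natCast ha, Gamma_add_natCast hb, Gamma_add_natCast hc] at hs
  convert! hs using 1
  have := poch_ne_zero ha (2 * l)
  have := poch_ne_zero hb l
  have := poch_ne_zero hc l
  have := Gamma_ne_zero_of_not_isNonposInt hb
  have := Gamma_ne_zero_of_not_isNonposInt hc
  have := Gamma_ne_zero_of_not_isNonposInt ha
  field_simp

lemma poch_ofReal_eq_norm {x : ℝ} (hx : 0 < x) (n : ℕ) : poch x n = (‖poch x n‖ : ℂ) := by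
  rw [poch_eq_prod, norm_prod, Complex.ofReal_prod]
  refine Finset.prod_congr rfl fun i _ => ?_
  have : (x : ℂ) + i = ((x + i : ℝ) : ℂ) := by push_cast; rfl
  rw [this, Complex.norm_real, Real.norm_of_nonneg (by positivity)]

/-- Positive parameters give positive terms, so Gauss's theorem evaluates the absolute sum as well.
-/
lemma tsum_norm_baileyKernel_ofReal {a b c : ℝ} (ha : 0 < 1 + a) (hb : 0 < b) (hc : 0 < c)
    (l : ℕ) :
    ∑' j, ‖baileyKernel a b c l j‖ = ‖∑' j, baileyKernel a b c l j‖ := by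
  have e : ∀ j, baileyKernel a b c l j = (‖baileyKernel a b c l j‖ : ℂ) := by
    intro j
    have h1 : (1 : ℂ) + a = ((1 + a : ℝ) : ℂ) := by push_cast; rfl
    rw [baileyKernel, norm_div, norm_mul, norm_mul, h1]
    push_cast
    rw [← poch_ofReal_eq_norm hb, ← poch_ofReal_eq_norm hc,
      show (1 : ℂ) + a = ((1 + a : ℝ) : ℂ) by push_cast; rfl, ← poch_ofReal_eq_norm ha]
    simp
  rw [tsum_congr e, ← Complex.ofReal_tsum, Complex.norm_real,
    Real.norm_of_nonneg (tsum_nonneg fun j => norm_nonneg _)]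

lemma exists_norm_poch_le (s : ℂ) {t : ℂ} (ht : ¬ IsNonposInt t) (hst : s.re = t.re) :
    ∃ C : ℝ, 0 < C ∧ ∀ n, ‖poch s n‖ ≤ C * ‖poch t n‖ := by
  obtain ⟨C, hC, h⟩ := polyBound_poch_div_poch s ht
  refine ⟨C, hC, fun n => ?_⟩
  have := h n
  rwa [hst, sub_self, Real.rpow_zero, mul_one, norm_div,
    div_le_iff₀ (norm_pos_iff.2 (poch_ne_zero ht n))] at this

lemma exists_norm_poch_shift_le (s : ℂ) (N : ℕ) (hN : 0 < s.re + N) :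
    ∃ C : ℝ, 0 < C ∧ ∀ n, ‖poch s (N + n)‖ ≤ C * ‖poch ((s.re + N : ℝ) : ℂ) n‖ := by
  obtain ⟨C, hC, h⟩ := exists_norm_poch_le (s + N) (t := ((s.re + N : ℝ) : ℂ))
    (not_isNonposInt_of_re_pos (by simpa using hN)) (by simp)
  refine ⟨(‖poch s N‖ + 1) * C, by positivity, fun n => ?_⟩
  rw [poch_add, norm_mul, mul_assoc]
  gcongr
  · linarith
  · exact h n

/-- The kernel of Bailey's lemma is dominated by the kernel with shifted real parameters. -/
lemma exists_norm_baileyKernel_shift_le {a b c : ℂ} (ha : ¬ IsNonposInt (1 + a)) (N : ℕ)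
    (haN : 0 < 1 + (a.re + 2 * N)) (hb : 0 < b.re + N) (hc : 0 < c.re + N) :
    ∃ C : ℝ, 0 < C ∧ ∀ l j, ‖baileyKernel a b c (l + N) j‖ ≤
      C * ‖baileyKernel ((a.re + 2 * N : ℝ) : ℂ) ((b.re + N : ℝ) : ℂ) ((c.re + N : ℝ) : ℂ) l j‖ := by
  obtain ⟨C₁, hC₁, h₁⟩ := exists_norm_poch_shift_le b N hb
  obtain ⟨C₂, hC₂, h₂⟩ := exists_norm_poch_shift_le c N hc
  have h0 := norm_pos_iff.2 (poch_ne_zero ha (2 * N))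
  refine ⟨C₁ * C₂ / ‖poch (1 + a) (2 * N)‖, by positivity, fun l j => ?_⟩
  have hpos : 0 < ((1 : ℂ) + ((a.re + 2 * N : ℝ) : ℂ)).re := by simpa using haN
  have h3 : ‖poch (1 + ((a.re + 2 * N : ℝ) : ℂ)) (2 * l + j)‖ * ‖poch (1 + a) (2 * N)‖ ≤
      ‖poch (1 + a) (2 * (l + N) + j)‖ := by
    rw [show 2 * (l + N) + j = 2 * N + (2 * l + j) by ring, poch_add (1 + a) (2 * N), norm_mul,
      mul_comm]
    refine mul_le_mul_of_nonneg_left (norm_poch_mono hpos (by simp) (by simp; linarith) _) (norm_nonneg _)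
  have hp := norm_pos_iff.2 (poch_ne_zero (not_isNonposInt_of_re_pos hpos) (2 * l + j))
  have hf := norm_pos_iff.2 (factorial_cast_ne_zero j)
  rw [baileyKernel, baileyKernel, norm_div, norm_div, norm_mul, norm_mul, norm_mul, norm_mul,
    show l + N + j = N + (l + j) by ring, div_mul_div_comm]
  refine div_le_div₀ (by positivity) ?_ (by positivity) ?_
  · calc _ ≤ _ := mul_le_mul (h₁ (l + j)) (h₂ (l + j)) (norm_nonneg _) (by positivity)
      _ = _ := by ring
  · calc _ = ‖(j.factorial : ℂ)‖ * (‖poch (1 + ((a.re + 2 * N : ℝ) : ℂ)) (2 * l + j)‖ *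
          ‖poch (1 + a) (2 * N)‖) := by ring
      _ ≤ _ := by gcongr

/-- Gauss's theorem does not evaluate sums of norms for complex parameters. Past a shift of `l` by
`N`, the kernel is dominated by one with positive real parameters; its absolute sum is known in
closed form and grows like `(l + 1)^(2 Re(b + c - 1 - a))`. -/
lemma summable_bailey {a b c : ℂ} (ha : ¬ IsNonposInt (1 + a)) (h : 0 < (1 + a - b - c).re)
    {α : ℕ → ℂ} (hα : Summable fun l : ℕ => ((l : ℝ) + 1) ^ (2 * (b + c - 1 - a).re) * ‖α l‖) :
    Summable fun p : ℕ × ℕ => ‖baileyKernel a b c p.1 p.2 * α p.1‖ := by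
  rw [summable_prod_of_nonneg (fun p => norm_nonneg _)]
  simp only [norm_mul]
  refine ⟨fun l => (summable_norm_baileyKernel ha h l).mul_right _, ?_⟩
  simp only [tsum_mul_right]
  -- The shift sends `a, b, c` to `Re a + 2N, Re b + N, Re c + N`. It makes `1 + a'`, `b'`, `c'`, `1
  -- + a' - b'`, `1 + a' - c'` positive and leaves `1 + a' - b' - c'` unchanged.
  obtain ⟨N, hN⟩ := exists_nat_gt (max (max (-b.re) (-c.re))
    (max (-(1 + a.re)) (max (-(1 + a.re - b.re)) (-(1 + a.re - c.re)))))
  simp only [max_lt_iff] at hN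
  obtain ⟨⟨hN1, hN2⟩, hN3, hN4, hN5⟩ := hN
  have hN0 : (0 : ℝ) ≤ N := N.cast_nonneg
  set a' : ℝ := a.re + 2 * N with ha'
  set b' : ℝ := b.re + N with hb'
  set c' : ℝ := c.re + N with hc'
  simp only [Complex.sub_re, Complex.add_re, Complex.one_re] at h hα
  have p1 : 0 < 1 + a' := by linarith
  have p2 : 0 < b' := by linarith
  have p3 : 0 < c' := by linarith
  have p4 : 0 < 1 + a' - b' - c' := by linarith
  obtain ⟨C, hC, hle⟩ := exists_norm_baileyKernel_shift_le ha N (b := b) (c := c) p1 p2 p3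
  have n1 : ¬ IsNonposInt (1 + (a' : ℂ)) := not_isNonposInt_of_re_pos (by simpa using p1)
  have n2 : ¬ IsNonposInt (1 + (a' : ℂ) - b') :=
    not_isNonposInt_of_re_pos (by simp; linarith)
  have n3 : ¬ IsNonposInt (1 + (a' : ℂ) - c') :=
    not_isNonposInt_of_re_pos (by simp; linarith)
  have n4 : 0 < (1 + (a' : ℂ) - b' - c').re := by simpa using p4
  have hsum := hasSum_baileyKernel n1 n2 n3 n4
  obtain ⟨D, hD, hDle⟩ := (polyBound_poch_div_poch (b' : ℂ) n2).mul
    (polyBound_poch_div_poch (c' : ℂ) n3)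
  set K := Complex.Gamma (1 + a') * Complex.Gamma (1 + a' - b' - c') /
        (Complex.Gamma (1 + a' - b') * Complex.Gamma (1 + a' - c'))
  set E : ℝ := 2 * (b.re + c.re - 1 - a.re) with hE
  have hE0 : E ≤ 0 := by rw [hE]; linarith
  rw [← summable_nat_add_iff N]
  refine Summable.of_nonneg_of_le (fun l => mul_nonneg (tsum_nonneg fun j => norm_nonneg _)
    (norm_nonneg _)) (fun l => ?_)
    (((summable_nat_add_iff N).2 hα).mul_left (C * (‖K‖ * (D * ((N : ℝ) + 1) ^ (-E)))))
  rw [← mul_assoc]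
  refine mul_le_mul_of_nonneg_right ?_ (norm_nonneg _)
  calc ∑' j, ‖baileyKernel a b c (l + N) j‖
      ≤ ∑' j, C * ‖baileyKernel (a' : ℂ) b' c' l j‖ :=
        (summable_norm_baileyKernel ha (by simpa using h) _).tsum_le_tsum (hle l)
          ((summable_norm_baileyKernel n1 n4 l).mul_left C)
    _ = C * (‖K‖ * ‖poch b' l / poch (1 + a' - b') l * (poch c' l / poch (1 + a' - c') l)‖) := by
        rw [tsum_mul_left, tsum_norm_baileyKernel_ofReal p1 p2 p3, (hsum l).tsum_eq, norm_mul]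
    _ ≤ C * (‖K‖ * (D * ((l : ℝ) + 1) ^ E)) := by
        gcongr
        convert! hDle l using 3
        simp only [Complex.sub_re, Complex.add_re, Complex.one_re, Complex.ofReal_re]
        rw [hE, ha', hb', hc']; ring
    _ ≤ C * (‖K‖ * (D * (((N : ℝ) + 1) ^ (-E) * (((l + N : ℕ) : ℝ) + 1) ^ E))) := by
        gcongr
        -- Since `E ≤ 0`, the inequality `l + N + 1 ≤ (N + 1)(l + 1)` reverses under the power and
        -- lets the unshifted weight be compared with the shifted one.
        have h1 : (((N : ℝ) + 1) * ((l : ℝ) + 1)) ^ E ≤ (((l + N : ℕ) : ℝ) + 1) ^ E := by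
          refine Real.rpow_le_rpow_of_nonpos (by positivity) ?_ hE0
          push_cast
          have : (0 : ℝ) ≤ (N : ℝ) * l := by positivity
          linarith
        rw [Real.mul_rpow (by positivity) (by positivity)] at h1
        rw [Real.rpow_neg (by positivity), ← div_eq_inv_mul, le_div_iff₀ (by positivity), mul_comm]
        exact h1
    _ = _ := by ring

/-- Bailey's lemma, nonterminating case. -/
theorem hasSum_bailey {a b c : ℂ} (ha : ¬ IsNonposInt (1 + a))
    (hb : ¬ IsNonposInt (1 + a - b)) (hc : ¬ IsNonposInt (1 + a - c))
    (h : 0 < (1 + a - b - c).re)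
    {α : ℕ → ℂ} (hα : Summable fun l : ℕ => ((l : ℝ) + 1) ^ (2 * (b + c - 1 - a).re) * ‖α l‖) :
    HasSum (fun k => poch b k * poch c k * baileyBeta a α k)
      (Complex.Gamma (1 + a) * Complex.Gamma (1 + a - b - c) /
        (Complex.Gamma (1 + a - b) * Complex.Gamma (1 + a - c)) *
        ∑' l, poch b l / poch (1 + a - b) l * (poch c l / poch (1 + a - c) l) * α l) := by
  have hF := (summable_bailey ha h hα).of_norm.hasSum
  -- The double series is summed in two ways: along rows of fixed `l` by Gauss, and along the
  -- antidiagonals `l + j = k`, where it yields `baileyBeta`.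
  have h1 := hF.prod_fiberwise fun l => ((hasSum_baileyKernel ha hb hc h l).mul_right (α l))
  have h2 := ((Finset.HasAntidiagonal.sigmaAntidiagonalEquivProd (A := ℕ)).hasSum_iff.2 hF).sigma
    (fun k => hasSum_fintype _)
  rw [← tsum_mul_left, tsum_congr (fun l => (mul_assoc _ _ (α l)).symm), h1.tsum_eq]
  convert! h2 using 1
  funext k
  simp only [Function.comp_def]
  rw [Finset.univ_eq_attach, Finset.HasAntidiagonal.sigmaAntidiagonalEquivProd]
  dsimp only [Equiv.coe_fn_mk]
  rw [Finset.sum_attach (Finset.HasAntidiagonal.antidiagonal k)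
    (fun p => baileyKernel a b c p.1 p.2 * α p.1), Finset.Nat.sum_antidiagonal_eq_sum_range_succ
    (fun l j => baileyKernel a b c l j * α l), baileyBeta, Finset.mul_sum]
  refine Finset.sum_congr rfl fun l hl => ?_
  have hl' : l ≤ k := by have := Finset.mem_range.1 hl; omega
  rw [baileyKernel, show l + (k - l) = k by omega, show 2 * l + (k - l) = k + l by omega]
  ring

end VasilyevZudilin

/-! ### Absolute convergence of the integral over the cube. -/

namespace VasilyevZudilin
open Filter Topology MeasureTheory Set

/-- The open unit cube. -/
def openCube (m : ℕ) : Set (Fin m → ℝ) := Set.univ.pi fun _ => Ioo (0 : ℝ) 1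

lemma measurableSet_openCube (m : ℕ) : MeasurableSet (openCube m) :=
  MeasurableSet.univ_pi fun _ => measurableSet_Ioo

lemma restrict_Icc_eq_openCube (m : ℕ) :
    (volume.restrict (Icc (0 : Fin m → ℝ) 1)) = volume.restrict (openCube m) :=
  (Measure.restrict_congr_set (Measure.univ_pi_Ioo_ae_eq_Icc (f := fun _ => (0 : ℝ))
    (g := fun _ => (1 : ℝ)))).symm

/-- The integrand of Euler's beta integral. -/
noncomputable def betaKernel (u v : ℂ) (t : ℝ) : ℂ := (t : ℂ) ^ (u - 1) * (1 - (t : ℂ)) ^ (v - 1)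

/-- A product of beta integrands. -/
noncomputable def betaWeight (p q : ℕ → ℂ) (m : ℕ) (x : Fin m → ℝ) : ℂ :=
  ∏ i : Fin m, betaKernel (p i) (q i) (x i)

lemma betaWeight_succ (p q : ℕ → ℂ) (m : ℕ) (x : Fin (m + 1) → ℝ) :
    betaWeight p q (m + 1) x = betaKernel (p 0) (q 0) (x 0) *
      betaWeight (fun i => p (i + 1)) (fun i => q (i + 1)) m (Fin.tail x) := by
  simp [betaWeight, Fin.prod_univ_succ, Fin.tail]

lemma measurable_betaKernel (u v : ℂ) : Measurable (betaKernel u v) := by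
  unfold betaKernel
  exact (Complex.measurable_ofReal.pow_const _).mul
    ((measurable_const.sub Complex.measurable_ofReal).pow_const _)

lemma measurable_betaWeight (p q : ℕ → ℂ) (m : ℕ) : Measurable (betaWeight p q m) := by
  unfold betaWeight
  exact Finset.measurable_fun_prod _ fun i _ =>
    (measurable_betaKernel _ _).comp (measurable_pi_apply i)

lemma continuous_nested (m : ℕ) : Continuous (nested m) := by
  induction m with
  | zero => exact continuous_const
  | succ m ih =>
    change Continuous fun x : Fin (m + 1) → ℝ => 1 - nested m (Fin.tail x) * x 0
    have : Continuous fun x : Fin (m + 1) → ℝ => (Fin.tail x : Fin m → ℝ) :=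
      continuous_pi fun i => continuous_apply i.succ
    exact continuous_const.sub ((ih.comp this).mul (continuous_apply 0))

lemma norm_betaKernel (u v : ℂ) {t : ℝ} (ht : t ∈ Ioo (0 : ℝ) 1) :
    ‖betaKernel u v t‖ = t ^ (u.re - 1) * (1 - t) ^ (v.re - 1) := by
  have e : (1 : ℂ) - t = ((1 - t : ℝ) : ℂ) := by push_cast; rfl
  rw [betaKernel, norm_mul, e, Complex.norm_cpow_eq_rpow_re_of_pos ht.1,
    Complex.norm_cpow_eq_rpow_re_of_pos (by linarith [ht.2])]
  simp

lemma integrableOn_betaKernel {u v : ℂ} (hu : 0 < u.re) (hv : 0 < v.re) :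
    IntegrableOn (betaKernel u v) (Ioo 0 1) := by
  have h := Complex.betaIntegral_convergent hu hv
  rw [intervalIntegrable_iff_integrableOn_Ioo_of_le zero_le_one] at h
  exact h

lemma setIntegral_betaKernel (u v : ℂ) :
    ∫ t in Ioo (0 : ℝ) 1, betaKernel u v t = Complex.betaIntegral u v := by
  rw [Complex.betaIntegral, intervalIntegral.integral_of_le zero_le_one, integral_Ioc_eq_integral_Ioo]
  rfl

lemma integrableOn_betaWeight {p q : ℕ → ℂ} {m : ℕ} (hp : ∀ i < m, 0 < (p i).re)
    (hq : ∀ i < m, 0 < (q i).re) : IntegrableOn (betaWeight p q m) (openCube m) := by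
  rw [IntegrableOn, openCube, volume_pi, Measure.restrict_pi_pi]
  exact Integrable.fintype_prod fun i => integrableOn_betaKernel (hp i i.2) (hq i i.2)

lemma tail_mem_openCube {m : ℕ} {x : Fin (m + 1) → ℝ} (hx : x ∈ openCube (m + 1)) :
    Fin.tail x ∈ openCube m := fun i _ => hx i.succ trivial

lemma nested_succ (m : ℕ) (x : Fin (m + 1) → ℝ) :
    nested (m + 1) x = 1 - nested m (Fin.tail x) * x 0 := rfl

lemma nested_pos_le_one (m : ℕ) (x : Fin m → ℝ) (hx : x ∈ openCube m) :
    0 < nested m x ∧ nested m x ≤ 1 := by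
  induction m with
  | zero => simp [nested]
  | succ m ih =>
    obtain ⟨h1, h2⟩ := ih _ (tail_mem_openCube hx)
    have h0 : x 0 ∈ Ioo (0 : ℝ) 1 := hx 0 trivial
    rw [nested_succ]
    constructor
    · nlinarith [h0.1, h0.2]
    · nlinarith [h0.1, h0.2]

lemma one_sub_le_nested (m : ℕ) (x : Fin (m + 1) → ℝ) (hx : x ∈ openCube (m + 1)) :
    1 - x 0 ≤ nested (m + 1) x := by
  have h0 : x 0 ∈ Ioo (0 : ℝ) 1 := hx 0 trivial
  have h1 := (nested_pos_le_one m _ (tail_mem_openCube hx)).2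
  rw [nested_succ]
  nlinarith [h0.1]

lemma prod_mul_one_sub_nonneg_le_one {m : ℕ} {x : Fin m → ℝ} (hx : x ∈ openCube m) :
    0 < ∏ i, x i * (1 - x i) ∧ ∏ i, x i * (1 - x i) ≤ 1 := by
  have h : ∀ i, 0 < x i * (1 - x i) ∧ x i * (1 - x i) ≤ 1 := fun i => by
    have h0 : x i ∈ Ioo (0 : ℝ) 1 := hx i trivial
    exact ⟨mul_pos h0.1 (by linarith [h0.2]), by nlinarith [h0.1, h0.2]⟩
  exact ⟨Finset.prod_pos fun i _ => (h i).1,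
    Finset.prod_le_one (fun i _ => (h i).1.le) fun i _ => (h i).2⟩

lemma prod_le_nested (m : ℕ) (x : Fin m → ℝ) (hx : x ∈ openCube m) :
    ∏ i, x i * (1 - x i) ≤ nested m x := by
  rcases m with _ | m
  · simp [nested]
  · have h0 : x 0 ∈ Ioo (0 : ℝ) 1 := hx 0 trivial
    obtain ⟨h1, h2⟩ := prod_mul_one_sub_nonneg_le_one (tail_mem_openCube hx)
    refine le_trans ?_ (one_sub_le_nested m x hx)
    rw [Fin.prod_univ_succ]
    simp only [Fin.tail] at h1 h2
    have : 0 ≤ 1 - x 0 := by linarith [h0.2]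
    calc x 0 * (1 - x 0) * ∏ i : Fin m, x i.succ * (1 - x i.succ) ≤ 1 * (1 - x 0) * 1 := by
          gcongr; exact h0.2.le
      _ = _ := by ring

/-- The nested expression is `(1 - x 0) + x 0 * x 1 * y`, with `y` the nested expression two levels
down. Keeping the second summand gives a lower bound free of the factor `1 - x 0`, which the other
bound `1 - x 0` uses up. -/
lemma mul_prod_le_nested (m : ℕ) (x : Fin (m + 2) → ℝ) (hx : x ∈ openCube (m + 2)) :
    x 0 * ∏ i : Fin (m + 1), x i.succ * (1 - x i.succ) ≤ nested (m + 2) x := by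
  have h0 : x 0 ∈ Ioo (0 : ℝ) 1 := hx 0 trivial
  have h1 : x 1 ∈ Ioo (0 : ℝ) 1 := hx 1 trivial
  have ht := tail_mem_openCube (tail_mem_openCube hx)
  have h2 := prod_le_nested m _ ht
  have h3 := (prod_mul_one_sub_nonneg_le_one ht).1
  rw [nested_succ, nested_succ, Fin.prod_univ_succ]
  simp only [Fin.tail, Fin.succ_zero_eq_one] at *
  have e1 : x 0 * (x 1 * (1 - x 1) * ∏ i : Fin m, x i.succ.succ * (1 - x i.succ.succ)) ≤
      x 0 * (x 1 * 1 * nested m (Fin.tail (Fin.tail x))) := by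
    have := h0.1
    have := h1.1
    have : 0 ≤ 1 - x 1 := by linarith [h1.2]
    gcongr
    linarith
  linarith [h0.2]

lemma norm_betaKernel_sub (u v : ℂ) (δ ε : ℝ) {t : ℝ} (ht : t ∈ Ioo (0 : ℝ) 1) :
    ‖betaKernel (u - δ) (v - ε) t‖ = ‖betaKernel u v t‖ * (t ^ (-δ) * (1 - t) ^ (-ε)) := by
  have h1 : 0 < 1 - t := by linarith [ht.2]
  rw [norm_betaKernel _ _ ht, norm_betaKernel _ _ ht,
    mul_mul_mul_comm, ← Real.rpow_add ht.1, ← Real.rpow_add h1]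
  simp only [Complex.sub_re, Complex.ofReal_re]
  congr 2 <;> ring

/-- The exponent is split as `(σ - δ) + δ` and the two lower bounds are used one on each part. A
little of the singularity is thus moved off `1 - x 0` onto the other endpoints. In dimension one the
nested expression is `1 - x 0` itself and nothing can be moved. -/
lemma nested_rpow_le {m : ℕ} {σ δ : ℝ} (hδ : 0 ≤ δ) (hδσ : δ ≤ σ) (hm : m = 0 → δ = 0)
    {x : Fin (m + 1) → ℝ} (hx : x ∈ openCube (m + 1)) :
    nested (m + 1) x ^ (-σ) ≤ (1 - x 0) ^ (-(σ - δ)) *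
      (x 0 * ∏ i : Fin m, x i.succ * (1 - x i.succ)) ^ (-δ) := by
  have hn := nested_pos_le_one _ x hx
  have h0 : x 0 ∈ Ioo (0 : ℝ) 1 := hx 0 trivial
  have h1 : 0 < 1 - x 0 := by linarith [h0.2]
  have hP : 0 < ∏ i : Fin m, x i.succ * (1 - x i.succ) :=
    (prod_mul_one_sub_nonneg_le_one (tail_mem_openCube hx)).1
  have e : nested (m + 1) x ^ (-σ) = nested (m + 1) x ^ (-(σ - δ)) * nested (m + 1) x ^ (-δ) := by
    rw [← Real.rpow_add hn.1]; congr 1; ring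
  rw [e]
  refine mul_le_mul (Real.rpow_le_rpow_of_nonpos h1 (one_sub_le_nested m x hx) (by linarith)) ?_
    (Real.rpow_nonneg hn.1.le _) (Real.rpow_nonneg h1.le _)
  rcases m with _ | m
  · simp [hm rfl]
  · exact Real.rpow_le_rpow_of_nonpos (mul_pos h0.1 hP) (mul_prod_le_nested m x hx) (by linarith)

lemma exists_small {m : ℕ} {f : ℕ → ℝ} (hf : ∀ i < m, 0 < f i) :
    ∃ δ : ℝ, 0 < δ ∧ ∀ i < m, δ < f i := by
  induction m with
  | zero => exact ⟨1, one_pos, fun i hi => absurd hi (Nat.not_lt_zero i)⟩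
  | succ m ih =>
    obtain ⟨δ, h1, h2⟩ := ih fun i hi => hf i (by omega)
    have h3 := hf m (by omega)
    refine ⟨min δ (f m / 2), by positivity, fun i hi => ?_⟩
    rcases Nat.lt_succ_iff_lt_or_eq.1 hi with h | rfl
    · exact (min_le_left _ _).trans_lt (h2 i h)
    · exact (min_le_right _ _).trans_lt (by linarith)

lemma integrableOn_norm_betaWeight_mul_nested {p q : ℕ → ℂ} {m : ℕ}
    (hp : ∀ i < m + 1, 0 < (p i).re) (hq : ∀ i < m + 1, 0 < (q i).re) {σ : ℝ} (hσ : 0 < σ)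
    (hσq : σ ≤ (q 0).re) (hm : m = 0 → σ < (q 0).re) :
    IntegrableOn (fun x => ‖betaWeight p q (m + 1) x‖ * nested (m + 1) x ^ (-σ))
      (openCube (m + 1)) := by
  -- In dimension at least two a small `δ > 0`, below every beta exponent, leaves `Re (q 0) - (σ -
  -- δ) > 0` even if `σ = Re (q 0)`; in dimension one `δ = 0` and the inequality must be strict.
  obtain ⟨δ, hδ, hδσ, hδm, hδp, hδq, hδ0⟩ : ∃ δ : ℝ, 0 ≤ δ ∧ δ ≤ σ ∧ (m = 0 → δ = 0) ∧
      (∀ i < m + 1, δ < (p i).re) ∧ (∀ i < m + 1, δ < (q i).re) ∧ 0 < (q 0).re - (σ - δ) := by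
    rcases m with _ | m
    · exact ⟨0, le_rfl, hσ.le, fun _ => rfl, hp, hq, by linarith [hm rfl]⟩
    · obtain ⟨δ₁, h1, h1'⟩ := exists_small hp
      obtain ⟨δ₂, h2, h2'⟩ := exists_small hq
      refine ⟨min σ (min δ₁ δ₂), by positivity, min_le_left _ _, by simp, fun i hi => ?_,
        fun i hi => ?_, ?_⟩
      · exact ((min_le_right _ _).trans (min_le_left _ _)).trans_lt (h1' i hi)
      · exact ((min_le_right _ _).trans (min_le_right _ _)).trans_lt (h2' i hi)
      · have : 0 < min σ (min δ₁ δ₂) := by positivity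
        linarith
  set p' : ℕ → ℂ := fun i => p i - δ
  set q' : ℕ → ℂ := fun i => q i - ((if i = 0 then σ - δ else δ : ℝ) : ℂ)
  have hint : IntegrableOn (betaWeight p' q' (m + 1)) (openCube (m + 1)) := by
    refine integrableOn_betaWeight (fun i hi => ?_) (fun i hi => ?_)
    · simpa [p'] using hδp i hi
    · rcases i with _ | i
      · simpa [q'] using hδ0
      · simpa [q'] using hδq _ hi
  refine Integrable.mono' hint.norm ?_ ?_
  · exact ((measurable_betaWeight _ _ _).norm.mul
      ((continuous_nested _).measurable.pow_const _)).aestronglyMeasurable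
  · refine (ae_restrict_iff' (measurableSet_openCube _)).2 (ae_of_all _ fun x hx => ?_)
    have h0 : x 0 ∈ Ioo (0 : ℝ) 1 := hx 0 trivial
    have hs : ∀ i : Fin m, x i.succ ∈ Ioo (0 : ℝ) 1 := fun i => hx i.succ trivial
    rw [Real.norm_of_nonneg (mul_nonneg (norm_nonneg _)
      (Real.rpow_nonneg (nested_pos_le_one _ x hx).1.le _))]
    calc ‖betaWeight p q (m + 1) x‖ * nested (m + 1) x ^ (-σ)
        ≤ ‖betaWeight p q (m + 1) x‖ * ((1 - x 0) ^ (-(σ - δ)) *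
          (x 0 * ∏ i : Fin m, x i.succ * (1 - x i.succ)) ^ (-δ)) :=
          mul_le_mul_of_nonneg_left (nested_rpow_le hδ hδσ hδm hx) (norm_nonneg _)
      _ = ‖betaWeight p' q' (m + 1) x‖ := by
        have e1 : ∀ i : Fin m, 0 ≤ x i.succ * (1 - x i.succ) := fun i =>
          mul_nonneg (hs i).1.le (by linarith [(hs i).2])
        rw [Real.mul_rpow h0.1.le (Finset.prod_nonneg fun i _ => e1 i),
          ← Real.finsetProd_rpow _ _ fun i _ => e1 i]
        simp only [betaWeight, Fin.prod_univ_succ, norm_mul, norm_prod]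
        have e2 : ∀ i : Fin m, ‖betaKernel (p' i.succ) (q' i.succ) (x i.succ)‖ =
            ‖betaKernel (p i.succ) (q i.succ) (x i.succ)‖ *
              (x i.succ * (1 - x i.succ)) ^ (-δ) := by
          intro i
          rw [Real.mul_rpow (hs i).1.le (by linarith [(hs i).2]), ← norm_betaKernel_sub _ _ _ _ (hs i)]
          simp [p', q']
        have e3 : ‖betaKernel (p' (0 : Fin (m + 1))) (q' (0 : Fin (m + 1))) (x 0)‖ =
            ‖betaKernel (p (0 : Fin (m + 1))) (q (0 : Fin (m + 1))) (x 0)‖ *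
              (x 0 ^ (-δ) * (1 - x 0) ^ (-(σ - δ))) := by
          rw [← norm_betaKernel_sub _ _ _ _ h0]
          simp [p', q']
        rw [e3, Finset.prod_congr rfl fun i _ => e2 i, Finset.prod_mul_distrib]
        ring

/-- Replacing `s` by a positive real `σ ≥ Re s` makes the binomial coefficients positive, so that
the binomial series of exponent `σ` can serve as a majorant. -/
lemma exists_exponent {s : ℂ} {Q : ℝ} {m : ℕ} (hQ : 0 < Q) (hs : s.re ≤ Q) (hm : m = 0 → s.re < Q) :
    ∃ σ : ℝ, 0 < σ ∧ s.re ≤ σ ∧ σ ≤ Q ∧ (m = 0 → σ < Q) := by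
  refine ⟨max s.re (Q / 2), by positivity, le_max_left _ _, max_le hs (by linarith), fun h => ?_⟩
  exact max_lt (hm h) (by linarith)

lemma norm_nested_cpow {m : ℕ} {x : Fin m → ℝ} (hx : x ∈ openCube m) (s : ℂ) :
    ‖(nested m x : ℂ) ^ (-s)‖ = nested m x ^ (-s.re) := by
  rw [Complex.norm_cpow_eq_rpow_re_of_pos (nested_pos_le_one m x hx).1, Complex.neg_re]

lemma measurable_nested_cpow (m : ℕ) (s : ℂ) : Measurable fun x => (nested m x : ℂ) ^ s :=
  (Complex.measurable_ofReal.comp (continuous_nested m).measurable).pow_const _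

/-- Absolute convergence of the Vasilyev-type integral. -/
lemma integrableOn_betaWeight_mul_nested {p q : ℕ → ℂ} {m : ℕ}
    (hp : ∀ i < m + 1, 0 < (p i).re) (hq : ∀ i < m + 1, 0 < (q i).re) {s : ℂ}
    (hs : s.re ≤ (q 0).re) (hm : m = 0 → s.re < (q 0).re) :
    IntegrableOn (fun x => betaWeight p q (m + 1) x * (nested (m + 1) x : ℂ) ^ (-s))
      (openCube (m + 1)) := by
  obtain ⟨σ, h1, h2, h3, h4⟩ := exists_exponent (hq 0 (by omega)) hs hm
  refine Integrable.mono' (integrableOn_norm_betaWeight_mul_nested hp hq h1 h3 h4) ?_ ?_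
  · exact ((measurable_betaWeight _ _ _).mul (measurable_nested_cpow _ _)).aestronglyMeasurable
  · refine (ae_restrict_iff' (measurableSet_openCube _)).2 (ae_of_all _ fun x hx => ?_)
    have hn := nested_pos_le_one _ x hx
    rw [norm_mul, norm_nested_cpow hx]
    exact mul_le_mul_of_nonneg_left
      (Real.rpow_le_rpow_of_exponent_ge hn.1 hn.2 (by linarith)) (norm_nonneg _)

/-! ### Expansion of the integral along its first variable. -/

/-- The binomial series. -/
lemma hasSum_poch_mul_pow (s : ℂ) {z : ℂ} (hz : ‖z‖ < 1) :
    HasSum (fun k => poch s k / k.factorial * z ^ k) ((1 - z) ^ (-s)) := by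
  have h := (Complex.one_div_one_sub_cpow_hasFPowerSeriesOnBall_zero s).hasSum (y := z)
    (by rw [← ENNReal.ofReal_one, Metric.eball_ofReal]; simpa using hz)
  simp only [FormalMultilinearSeries.ofScalars_apply_eq, zero_add] at h
  rw [one_div, ← Complex.cpow_neg] at h
  convert! h using 2 with k
  rw [Ring.choose, show s + k - 1 - k + 1 = s by ring, smul_eq_mul]
  congr 1
  have h2 := Ring.factorial_nsmul_multichoose_eq_ascPochhammer s k
  rw [Polynomial.ascPochhammer_smeval_eq_eval, nsmul_eq_mul] at h2
  rw [div_eq_iff (factorial_cast_ne_zero k), poch, ← h2, mul_comm]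

lemma hasSum_norm_poch_mul_pow {σ : ℝ} (hσ : 0 < σ) {y : ℝ} (hy0 : 0 ≤ y) (hy : y < 1) :
    HasSum (fun k : ℕ => ‖poch σ k‖ / k.factorial * y ^ k) ((1 - y) ^ (-σ)) := by
  have h := hasSum_poch_mul_pow σ (z := y) (by rwa [Complex.norm_real, Real.norm_of_nonneg hy0])
  rw [← Complex.hasSum_ofReal, Complex.ofReal_cpow (by linarith)]
  push_cast
  convert! h using 3 with k
  rw [← poch_ofReal_eq_norm hσ]

/-- The cube `(0,1)^(m+1)` as a product. -/
lemma setIntegral_openCube_succ (m : ℕ) (f : (Fin (m + 1) → ℝ) → ℂ) :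
    ∫ x in openCube (m + 1), f x =
      ∫ z in Ioo (0 : ℝ) 1 ×ˢ openCube m, f (Fin.cons z.1 z.2) := by
  have hmp := (volume_preserving_piFinSuccAbove (fun _ : Fin (m + 1) => ℝ) 0).symm
  rw [← hmp.setIntegral_preimage_emb (MeasurableEquiv.measurableEmbedding _)]
  have e : ((MeasurableEquiv.piFinSuccAbove (fun _ : Fin (m + 1) => ℝ) 0).symm ⁻¹' openCube (m + 1)) =
      Ioo (0 : ℝ) 1 ×ˢ openCube m := by
    ext z
    simp [openCube, MeasurableEquiv.piFinSuccAbove_symm_apply, Fin.forall_fin_succ]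
  rw [e]
  simp [MeasurableEquiv.piFinSuccAbove_symm_apply]
  rfl

/-- The Vasilyev-type integral with beta exponents `p`, `q` and denominator exponent `s`. -/
noncomputable def nestedIntegral (p q : ℕ → ℂ) (m : ℕ) (s : ℂ) : ℂ :=
  ∫ x in openCube m, betaWeight p q m x * (nested m x : ℂ) ^ (-s)

/-- In a single power the first variable separates from the rest. The remaining integral has the
denominator exponent `-k`, hence is of the terminating type. -/
lemma setIntegral_betaWeight_mul_pow (p q : ℕ → ℂ) (m k : ℕ) :
    ∫ x in openCube (m + 1), betaWeight p q (m + 1) x *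
        ((nested m (Fin.tail x) : ℂ) * (x 0 : ℂ)) ^ k =
      Complex.betaIntegral (p 0 + k) (q 0) *
        nestedIntegral (fun i => p (i + 1)) (fun i => q (i + 1)) m (-k) := by
  rw [setIntegral_openCube_succ, nestedIntegral, ← setIntegral_betaKernel, ← setIntegral_prod_mul]
  refine setIntegral_congr_fun (measurableSet_Ioo.prod (measurableSet_openCube m)) fun z hz => ?_
  have hz0 : (z.1 : ℂ) ≠ 0 := by exact_mod_cast hz.1.1.ne'
  simp only [betaWeight_succ, Fin.cons_zero, Fin.tail_cons, neg_neg, Complex.cpow_natCast, mul_pow,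
    betaKernel]
  rw [show p 0 + k - 1 = p 0 - 1 + k by ring, Complex.cpow_add _ _ hz0, Complex.cpow_natCast]
  ring

/-- Expansion of the Vasilyev-type integral along its first variable. -/
lemma hasSum_nestedIntegral_succ {p q : ℕ → ℂ} {m : ℕ}
    (hp : ∀ i < m + 1, 0 < (p i).re) (hq : ∀ i < m + 1, 0 < (q i).re) {s : ℂ}
    (hs : s.re ≤ (q 0).re) (hm : m = 0 → s.re < (q 0).re) :
    HasSum (fun k : ℕ => poch s k / k.factorial * (Complex.betaIntegral (p 0 + k) (q 0) *
        nestedIntegral (fun i => p (i + 1)) (fun i => q (i + 1)) m (-k)))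
      (nestedIntegral p q (m + 1) s) := by
  -- The majorant is `C (σ)_k / k!` times the power; it sums to a multiple of `nested ^ (-σ)`,
  -- integrable against the weight, so dominated convergence applies.
  obtain ⟨σ, h1, h2, h3, h4⟩ := exists_exponent (hq 0 (by omega)) hs hm
  obtain ⟨C, hC, hCle⟩ : ∃ C : ℝ, 0 < C ∧ ∀ n, ‖poch s n‖ ≤ C * ‖poch σ n‖ := by
    obtain ⟨C, hC, h⟩ := polyBound_poch_div_poch s (t := σ)
      (not_isNonposInt_of_re_pos (by simpa using h1))
    refine ⟨C, hC, fun n => ?_⟩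
    have h5 := h n
    rw [norm_div, div_le_iff₀ (norm_pos_iff.2
      (poch_ne_zero (not_isNonposInt_of_re_pos (by simpa using h1)) n))] at h5
    refine h5.trans (mul_le_mul_of_nonneg_right ?_ (norm_nonneg _))
    refine mul_le_of_le_one_right hC.le (Real.rpow_le_one_of_one_le_of_nonpos ?_ ?_)
    · linarith [(Nat.cast_nonneg n : (0 : ℝ) ≤ n)]
    · simpa using h2
  have hy : ∀ x ∈ openCube (m + 1), 0 ≤ nested m (Fin.tail x) * x 0 ∧
      nested m (Fin.tail x) * x 0 < 1 := fun x hx => by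
    have := (nested_pos_le_one _ x hx).1
    rw [nested_succ] at this
    exact ⟨mul_nonneg (nested_pos_le_one m _ (tail_mem_openCube hx)).1.le (hx 0 trivial).1.le,
      by linarith⟩
  have hS : ∀ x ∈ openCube (m + 1), HasSum (fun k : ℕ => C * ‖betaWeight p q (m + 1) x‖ *
      (‖poch σ k‖ / k.factorial * (nested m (Fin.tail x) * x 0) ^ k))
      (C * ‖betaWeight p q (m + 1) x‖ * nested (m + 1) x ^ (-σ)) := fun x hx =>
    (hasSum_norm_poch_mul_pow h1 (hy x hx).1 (hy x hx).2).mul_left _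
  have key : HasSum (fun k : ℕ => ∫ x in openCube (m + 1), poch s k / k.factorial *
      (betaWeight p q (m + 1) x * ((nested m (Fin.tail x) : ℂ) * (x 0 : ℂ)) ^ k))
      (nestedIntegral p q (m + 1) s) := by
    have hae : ∀ {P : (Fin (m + 1) → ℝ) → Prop}, (∀ x ∈ openCube (m + 1), P x) →
        ∀ᵐ x ∂(volume.restrict (openCube (m + 1))), P x := fun h =>
      (ae_restrict_iff' (measurableSet_openCube _)).2 (ae_of_all _ h)
    refine hasSum_integral_of_dominated_convergence
      (fun k x => C * ‖betaWeight p q (m + 1) x‖ *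
        (‖poch σ k‖ / k.factorial * (nested m (Fin.tail x) * x 0) ^ k))
      (fun k => ?_) (fun k => hae fun x hx => ?_) (hae fun x hx => (hS x hx).summable) ?_
      (hae fun x hx => ?_)
    · have ht : Measurable fun x : Fin (m + 1) → ℝ => (Fin.tail x : Fin m → ℝ) :=
        measurable_pi_lambda _ fun i => measurable_pi_apply i.succ
      refine (Measurable.const_mul (Measurable.mul (measurable_betaWeight p q (m + 1))
        (Measurable.pow_const (Measurable.mul ?_ ?_) k)) _).aestronglyMeasurable
      · exact Complex.measurable_ofReal.comp ((continuous_nested m).measurable.comp ht)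
      · exact Complex.measurable_ofReal.comp (measurable_pi_apply 0)
    · have hk : (0 : ℝ) < k.factorial := by exact_mod_cast k.factorial_pos
      rw [norm_mul, norm_mul, norm_div, norm_pow, ← Complex.ofReal_mul, Complex.norm_real,
        Real.norm_of_nonneg (hy x hx).1, Complex.norm_natCast]
      have := (hy x hx).1
      calc _ ≤ C * ‖poch σ k‖ / k.factorial * (‖betaWeight p q (m + 1) x‖ *
            (nested m (Fin.tail x) * x 0) ^ k) := by
            gcongr
            exact hCle k
        _ = _ := by ring
    · refine ((integrableOn_norm_betaWeight_mul_nested hp hq h1 h3 h4).const_mul C).congr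
        (hae fun x hx => ?_)
      beta_reduce
      rw [(hS x hx).tsum_eq, mul_assoc]
    · have hz : ‖((nested m (Fin.tail x) : ℂ) * (x 0 : ℂ))‖ < 1 := by
        rw [← Complex.ofReal_mul, Complex.norm_real, Real.norm_of_nonneg (hy x hx).1]
        exact (hy x hx).2
      have h := (hasSum_poch_mul_pow s hz).mul_left (betaWeight p q (m + 1) x)
      rw [nested_succ]
      push_cast
      convert! h using 2 with k
      ring
  simpa only [integral_const_mul, setIntegral_betaWeight_mul_pow] using key

end VasilyevZudilin

/-! ### The terminating identity, by induction on the dimension. -/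

namespace VasilyevZudilin
open Filter Topology MeasureTheory Set

lemma betaIntegral_add_natCast {u v : ℂ} (hu : 0 < u.re) (hv : 0 < v.re) (k : ℕ) :
    Complex.betaIntegral (u + k) v = Complex.betaIntegral u v * (poch u k / poch (u + v) k) := by
  have hk : (0 : ℝ) ≤ k := k.cast_nonneg
  have huv : ¬ IsNonposInt (u + v) := not_isNonposInt_of_re_pos (by simp; linarith)
  rw [Complex.betaIntegral_eq_Gamma_mul_div _ _ (by simp; linarith) hv,
    Complex.betaIntegral_eq_Gamma_mul_div _ _ hu hv, add_right_comm, Gamma_add_natCast huv,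
    Gamma_add_natCast (not_isNonposInt_of_re_pos hu)]
  have := poch_ne_zero huv k
  have := Gamma_ne_zero_of_not_isNonposInt huv
  field_simp

/-- The second beta exponents `1 + a - c (i + 1) - c i` of the well-poised integral. -/
def wpExponent (a : ℂ) (c : ℕ → ℂ) (i : ℕ) : ℂ := 1 + a - c (i + 1) - c i

/-- The normalising product of beta integrals. -/
noncomputable def betaProd (a : ℂ) (c : ℕ → ℂ) (m : ℕ) : ℂ :=
  ∏ i ∈ Finset.range m, Complex.betaIntegral (c i) (wpExponent a c i)

lemma betaProd_succ (a : ℂ) (c : ℕ → ℂ) (m : ℕ) :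
    betaProd a c (m + 1) =
      betaProd a (fun i => c (i + 1)) m * Complex.betaIntegral (c 0) (wpExponent a c 0) := by
  rw [betaProd, Finset.prod_range_succ']
  rfl

/-- The terminating case of the identity, in terms of a Bailey pair. -/
def TerminatingIdentity (a : ℂ) (c : ℕ → ℂ) (m : ℕ) : Prop := ∀ n : ℕ,
  nestedIntegral c (wpExponent a c) m (-n) = betaProd a c m *
    (n.factorial * poch (1 + a - c 0) n * baileyBeta a (vwpAlpha a c m) n)

lemma hasSum_nestedIntegral_of_terminatingIdentity {a : ℂ} {c : ℕ → ℂ} {m : ℕ}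
    (hT : TerminatingIdentity a (fun i => c (i + 1)) m)
    (hpos : ∀ i < m + 1, 0 < (c i).re ∧ 0 < (wpExponent a c i).re) {s : ℂ}
    (hs : s.re ≤ (wpExponent a c 0).re) (hm : m = 0 → s.re < (wpExponent a c 0).re) :
    HasSum (fun k : ℕ => betaProd a c (m + 1) *
        (poch s k * poch (c 0) k * baileyBeta a (vwpAlpha a (fun i => c (i + 1)) m) k))
      (nestedIntegral c (wpExponent a c) (m + 1) s) := by
  have h := hasSum_nestedIntegral_succ (fun i hi => (hpos i hi).1) (fun i hi => (hpos i hi).2) hs hm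
  convert! h using 2 with k
  obtain ⟨h1, h2⟩ := hpos 0 (by omega)
  have hT' := hT k
  rw [betaIntegral_add_natCast h1 h2]
  change _ = _ * (_ * nestedIntegral (fun i => c (i + 1)) (wpExponent a fun i => c (i + 1)) m (-k))
  rw [hT', betaProd_succ]
  -- This is where well-poisedness enters: the denominator `(c 0 + q 0)_k` of the beta quotient is
  -- the factor `(1 + a - c 1)_k` in the terminating value, and `k!` cancels likewise.
  have e : c 0 + wpExponent a c 0 = 1 + a - c (0 + 1) := by rw [wpExponent]; ring
  have hre : 0 < (1 + a - c (0 + 1)).re := by rw [← e, Complex.add_re]; linarith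
  rw [e]
  have := poch_ne_zero (not_isNonposInt_of_re_pos hre) k
  have := factorial_cast_ne_zero k
  field_simp

/-- For exponent `-n` the expansion along the first variable stops at `k = n`, and `bailey_finite`
turns the finite sum into the `β` of the pair with the parameter `c 0` inserted. In dimension 0 the
cube is a point of mass 1. -/
lemma terminatingIdentity {a : ℂ} (h0 : a ≠ 0) (ha : ¬ IsNonposInt (1 + a)) (m : ℕ) (c : ℕ → ℂ)
    (hc : ∀ i ≤ m, ¬ IsNonposInt (1 + a - c i))
    (hpos : ∀ i < m, 0 < (c i).re ∧ 0 < (wpExponent a c i).re) : TerminatingIdentity a c m := by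
  induction m generalizing c with
  | zero =>
    intro n
    rw [baileyBeta_vwpAlpha_zero h0 ha (hc 0 le_rfl)]
    simp [nestedIntegral, betaProd, openCube, betaWeight, nested, volume_pi, measureReal_def,
      Measure.pi_pi]
  | succ m ih =>
    intro n
    have hT := ih (fun i => c (i + 1)) (fun i hi => hc (i + 1) (by omega))
      (fun i hi => hpos (i + 1) (by omega))
    have hq := (hpos 0 (by omega)).2
    have hn : (-(n : ℂ)).re < (wpExponent a c 0).re := by
      have : (0 : ℝ) ≤ n := n.cast_nonneg
      simp only [Complex.neg_re, Complex.natCast_re]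
      linarith
    have h1 := hasSum_nestedIntegral_of_terminatingIdentity hT hpos (s := -n) hn.le fun _ => hn
    have h2 := hasSum_sum_of_ne_finset_zero (L := SummationFilter.unconditional ℕ) (s := Finset.range (n + 1))
      (f := fun k : ℕ => betaProd a c (m + 1) *
        (poch (-n) k * poch (c 0) k * baileyBeta a (vwpAlpha a (fun i => c (i + 1)) m) k))
      (fun k hk => by
        rw [poch_neg_natCast_eq_zero (by simpa using hk)]; simp)
    rw [h1.unique h2, ← Finset.mul_sum, bailey_finite ha (hc 0 (by omega))]
    congr 3
    funext l
    rw [vwpAlpha_succ]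

/-! ### Growth of the very-well-poised terms and translation of the parameters. -/

/-- `(a)_l / l!` contributes `Re a - 1`, and the quotient with half parameters contributes 1. -/
lemma polyBound_vwp {a : ℂ} (ha : ¬ IsNonposInt a) : PolyBound (vwp a) a.re := by
  have h := (polyBound_poch_div_factorial a).mul
    (polyBound_poch_div_poch (a / 2 + 1) (not_isNonposInt_half ha))
  have e : a.re - 1 + ((a / 2 + 1).re - (a / 2).re) = a.re := by simp
  rw [e] at h
  refine h.congr_norm fun n => ?_
  rw [vwp, mul_div_mul_comm]

lemma polyBound_vwp_mul_prod {a : ℂ} (ha : ¬ IsNonposInt a) (c : ℕ → ℂ) (m : ℕ)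
    (hc : ∀ i < m, ¬ IsNonposInt (1 + a - c i)) :
    PolyBound (fun l => vwp a l * ∏ i ∈ Finset.range m, poch (c i) l / poch (1 + a - c i) l)
      (a.re + ∑ i ∈ Finset.range m, ((c i).re - (1 + a - c i).re)) :=
  (polyBound_vwp ha).mul (PolyBound.prod _ fun i hi =>
    polyBound_poch_div_poch _ (hc i (Finset.mem_range.1 hi)))

lemma norm_vwpAlpha (a : ℂ) (c : ℕ → ℂ) (m l : ℕ) : ‖vwpAlpha a c m l‖ =
    ‖vwp a l * ∏ i ∈ Finset.range (m + 1), poch (c i) l / poch (1 + a - c i) l‖ := by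
  rw [vwpAlpha, mul_assoc, norm_mul]; simp

lemma PolyBound.summable_rpow_mul_norm {f : ℕ → ℂ} {e E : ℝ} (hf : PolyBound f e)
    (h : E + e < -1) : Summable fun l : ℕ => ((l : ℝ) + 1) ^ E * ‖f l‖ := by
  obtain ⟨C, hC, hle⟩ := hf
  refine Summable.of_nonneg_of_le (fun l => by positivity) (fun l => ?_)
    ((summable_add_one_rpow h).mul_left C)
  rw [Real.rpow_add (by positivity)]
  calc ((l : ℝ) + 1) ^ E * ‖f l‖ ≤ ((l : ℝ) + 1) ^ E * (C * ((l : ℝ) + 1) ^ e) := by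
        gcongr; exact hle l
    _ = _ := by ring

lemma hypTerm_eq (m : ℕ) (h : ℕ → ℂ) (k : ℕ) :
    hypTerm (upperF m h) (lowerF m h) ((-1) ^ (m + 1)) k = (-1) ^ ((m + 1) * k) *
      (vwp (h 0) k * ∏ i ∈ Finset.range (m + 2),
        poch (h (i + 1)) k / poch (1 + h 0 - h (i + 1)) k) := by
  rw [hypTerm, Fin.prod_univ_succ, Fin.prod_univ_succ, Fin.prod_univ_succ (n := m + 2)]
  simp only [upperF, lowerF, Fin.cons_zero, Fin.cons_succ]
  rw [Finset.prod_range (fun i => poch (h (i + 1)) k / poch (1 + h 0 - h (i + 1)) k),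
    Finset.prod_div_distrib, vwp, ← pow_mul]
  simp only [poch, div_eq_mul_inv, mul_inv]
  ring

lemma vasQ_one (m : ℕ) (x : Fin m → ℝ) : vasQ m x 1 = nested m x := by
  rcases m with _ | m
  · simp [vasQ, nested]
  · simp [vasQ, nested]

lemma vasIntegrand_eq (m : ℕ) (h : ℕ → ℂ) (x : Fin m → ℝ) :
    vasIntegrand (upperJ m h) (lowerJ m h) 1 x =
      betaWeight (fun i => h (i + 2)) (wpExponent (h 0) fun i => h (i + 2)) m x *
        (nested m x : ℂ) ^ (-h 1) := by
  rw [vasIntegrand, vasQ_one, Complex.cpow_neg, div_eq_mul_inv]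
  rfl

lemma prod_Icc_add {M : Type*} [CommMonoid M] (f : ℕ → M) (k n : ℕ) :
    ∏ j ∈ Finset.Icc k (n + k), f j = ∏ i ∈ Finset.range (n + 1), f (i + k) := by
  have : Finset.Icc k (n + k) = Finset.Ico k (n + 1 + k) := by ext; simp; omega
  rw [this, Finset.prod_Ico_eq_prod_range, Nat.add_sub_cancel]
  exact Finset.prod_congr rfl fun i _ => by rw [add_comm k i]

lemma sum_Icc_add {M : Type*} [AddCommMonoid M] (f : ℕ → M) (k n : ℕ) :
    ∑ j ∈ Finset.Icc k (n + k), f j = ∑ i ∈ Finset.range (n + 1), f (i + k) :=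
  prod_Icc_add (M := Multiplicative M) f k n

lemma betaProd_eq {a : ℂ} {c : ℕ → ℂ} {m : ℕ}
    (hpos : ∀ i < m, 0 < (c i).re ∧ 0 < (wpExponent a c i).re) :
    betaProd a c m = (∏ i ∈ Finset.range m, Complex.Gamma (c i)) *
      (∏ i ∈ Finset.range m, Complex.Gamma (1 + a - c i - c (i + 1))) /
        ∏ i ∈ Finset.range m, Complex.Gamma (1 + a - c (i + 1)) := by
  rw [← Finset.prod_mul_distrib, ← Finset.prod_div_distrib]
  refine Finset.prod_congr rfl fun i hi => ?_
  obtain ⟨h1, h2⟩ := hpos i (Finset.mem_range.1 hi)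
  rw [Complex.betaIntegral_eq_Gamma_mul_div _ _ h1 h2, wpExponent,
    show c i + (1 + a - c (i + 1) - c i) = 1 + a - c (i + 1) by ring,
    show 1 + a - c (i + 1) - c i = 1 + a - c i - c (i + 1) by ring]

/-- The Gamma factor of the identity. -/
lemma gamma_prefactor_eq {h : ℕ → ℂ} {m : ℕ}
    (hpos : ∀ i < m + 1, 0 < (h (i + 2)).re ∧
      0 < (wpExponent (h 0) (fun i => h (i + 2)) i).re) :
    Complex.Gamma (1 + h 0) * (∏ j ∈ Finset.Icc 2 (m + 1 + 1), Complex.Gamma (h j)) /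
        (∏ j ∈ Finset.Icc 1 (m + 1 + 2), Complex.Gamma (1 + h 0 - h j)) *
      (∏ j ∈ Finset.Icc 1 (m + 1 + 1), Complex.Gamma (1 + h 0 - h j - h (j + 1))) =
    betaProd (h 0) (fun i => h (i + 2)) (m + 1) *
      (Complex.Gamma (1 + h 0) * Complex.Gamma (1 + h 0 - h 1 - h 2) /
        (Complex.Gamma (1 + h 0 - h 1) * Complex.Gamma (1 + h 0 - h 2))) := by
  rw [betaProd_eq hpos, prod_Icc_add (fun j => Complex.Gamma (h j)) 2 m,
    prod_Icc_add (fun j => Complex.Gamma (1 + h 0 - h j)) 1 (m + 2),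
    prod_Icc_add (fun j => Complex.Gamma (1 + h 0 - h j - h (j + 1))) 1 (m + 1),
    Finset.prod_range_succ' _ (m + 2), Finset.prod_range_succ' _ (m + 1),
    Finset.prod_range_succ' _ (m + 1)]
  simp only [div_eq_mul_inv, mul_inv]
  ring

/-- Here `S` is the very-well-poised series, `u_i` stands for `Γ(1 + h 0 - h i)`, `g_ij` for `Γ(1 +
h 0 - h i - h j)`. The lemma converts the evaluation of `S` by the pair `(2, 3)` into the prefactor
belonging to the pair `(1, 2)`. If `g₁₃ = 0`, both sides are 0. -/
lemma Gamma_dougall_eq {u₁ u₂ u₃ w g g₁₂ g₁₃ g₂₃ S : ℂ} (h₁ : u₁ ≠ 0) (h₂ : u₂ ≠ 0) (h₃ : u₃ ≠ 0)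
    (h₁₂ : g₁₂ ≠ 0) (h₂₃ : g₂₃ ≠ 0)
    (hS : g * g₂₃ / (u₂ * u₃) * S = u₁ * w / (g₁₂ * g₁₃)) :
    u₃ * w / (g₁₃ * g₂₃) = g * g₁₂ / (u₁ * u₂) * S := by
  rcases eq_or_ne g₁₃ 0 with rfl | h₁₃
  · simp only [zero_mul, mul_zero, div_zero] at hS ⊢
    have : g * S = 0 := by
      rcases mul_eq_zero.1 hS with h | h
      · rcases div_eq_zero_iff.1 h with h | h
        · rcases mul_eq_zero.1 h with h | h
          · rw [h, zero_mul]
          · exact absurd h h₂₃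
        · exact absurd h (mul_ne_zero h₂ h₃)
      · rw [h, mul_zero]
    linear_combination -(g₁₂ / (u₁ * u₂)) * this
  · field_simp at hS ⊢
    linear_combination -hS

end VasilyevZudilin

/-! ### The two cases `m ≥ 2` and `m = 1`, and the theorem. -/

namespace VasilyevZudilin
open Filter Topology MeasureTheory Set

/-- The real part of the excess of the very-well-poised series. -/
lemma series_exponent_lt {m : ℕ} {h : ℕ → ℂ}
    (hseries : 1 + (h 0).re > 2 / ((m : ℝ) + 1) * ∑ j ∈ Finset.Icc 1 (m + 2), (h j).re) :
    (h 0).re + ∑ i ∈ Finset.range (m + 2), ((h (i + 1)).re - (1 + h 0 - h (i + 1)).re) < -1 := by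
  rw [sum_Icc_add (fun j => (h j).re) 1 (m + 1)] at hseries
  have e : ∀ i ∈ Finset.range (m + 2), (h (i + 1)).re - (1 + h 0 - h (i + 1)).re =
      2 * (h (i + 1)).re - (1 + (h 0).re) := fun i _ => by simp; ring
  rw [Finset.sum_congr rfl e, Finset.sum_sub_distrib, ← Finset.mul_sum]
  have hm : (0 : ℝ) < m + 1 := by positivity
  have h2 := mul_lt_mul_of_pos_right hseries hm
  rw [div_mul_eq_mul_div, div_mul_cancel₀ _ hm.ne'] at h2
  simp
  linarith

/-- `J_m` for `m ≥ 2` via Bailey's lemma with the pair `h 1`, `h 2`. -/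
lemma nestedIntegral_eq_of_two_le {m : ℕ} {h : ℕ → ℂ} (h0 : h 0 ≠ 0)
    (ha : ¬ IsNonposInt (1 + h 0)) (hnp : ∀ i < m + 4, ¬ IsNonposInt (1 + h 0 - h (i + 1)))
    (hpos : ∀ i < m + 2, 0 < (h (i + 2)).re ∧
      0 < (wpExponent (h 0) (fun i => h (i + 2)) i).re)
    (hint : (h 1).re ≤ (wpExponent (h 0) (fun i => h (i + 2)) 0).re)
    (h12 : 0 < (1 + h 0 - h 1 - h 2).re)
    (hlt : (h 0).re + ∑ i ∈ Finset.range (m + 4),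
      ((h (i + 1)).re - (1 + h 0 - h (i + 1)).re) < -1) :
    nestedIntegral (fun i => h (i + 2)) (wpExponent (h 0) fun i => h (i + 2)) (m + 2) (h 1) =
      betaProd (h 0) (fun i => h (i + 2)) (m + 2) *
      (Complex.Gamma (1 + h 0) * Complex.Gamma (1 + h 0 - h 1 - h 2) /
        (Complex.Gamma (1 + h 0 - h 1) * Complex.Gamma (1 + h 0 - h 2)) *
        hypF (upperF (m + 2) h) (lowerF (m + 2) h) ((-1) ^ (m + 2 + 1))) := by
  have ha' := not_isNonposInt_of_one_add h0 ha
  have hT := terminatingIdentity h0 ha (m + 1) (fun i => h (i + 3))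
    (fun i hi => hnp (i + 2) (by omega)) (fun i hi => hpos (i + 1) (by omega))
  have hJ := hasSum_nestedIntegral_of_terminatingIdentity (c := fun i => h (i + 2)) hT hpos hint
    (fun h => absurd h (by omega))
  have hα : PolyBound (vwpAlpha (h 0) (fun i => h (i + 3)) (m + 1)) _ :=
    (polyBound_vwp_mul_prod ha' (fun i => h (i + 3)) (m + 2)
      (fun i hi => hnp (i + 2) (by omega))).congr_norm fun l => norm_vwpAlpha _ _ _ _
  -- The weight exponent `2 Re(h 1 + h 2 - 1 - h 0)` is what the two parameters missing from `α` add
  -- to the growth exponent, so the required bound is exactly `hlt`.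
  have hB := (hasSum_bailey ha (hnp 0 (by omega)) (hnp 1 (by omega)) h12
    (hα.summable_rpow_mul_norm (by
      rw [Finset.sum_range_succ', Finset.sum_range_succ'] at hlt
      simp only [Complex.add_re, Complex.sub_re, Complex.one_re, zero_add] at hlt ⊢
      linarith))).mul_left (betaProd (h 0) (fun i => h (i + 2)) (m + 2))
  rw [hJ.unique hB, hypF]
  congr 3
  funext l
  rw [hypTerm_eq, vwpAlpha, Finset.prod_range_succ' _ (m + 3), Finset.prod_range_succ' _ (m + 2),
    show (m + 2 + 1) * l = (m + 1) * l + 2 * l by ring, pow_add, pow_mul (-1 : ℂ) 2]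
  simp
  ring

/-- `J_1` via Bailey's lemma with the pair `h 2`, `h 3`, that is, Dougall's `₅F₄` sum. -/
lemma nestedIntegral_one_eq {h : ℕ → ℂ} (h0 : h 0 ≠ 0)
    (ha : ¬ IsNonposInt (1 + h 0)) (hnp : ∀ i < 3, ¬ IsNonposInt (1 + h 0 - h (i + 1)))
    (h12 : ¬ IsNonposInt (1 + h 0 - h 1 - h 2))
    (hpos : ∀ i < 1, 0 < (h (i + 2)).re ∧ 0 < (wpExponent (h 0) (fun i => h (i + 2)) i).re)
    (h123 : 0 < (1 + h 0 - h 1 - h 2 - h 3).re)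
    (hlt : (h 0).re + ∑ i ∈ Finset.range 3,
      ((h (i + 1)).re - (1 + h 0 - h (i + 1)).re) < -1) :
    nestedIntegral (fun i => h (i + 2)) (wpExponent (h 0) fun i => h (i + 2)) 1 (h 1) =
      betaProd (h 0) (fun i => h (i + 2)) 1 *
      (Complex.Gamma (1 + h 0) * Complex.Gamma (1 + h 0 - h 1 - h 2) /
        (Complex.Gamma (1 + h 0 - h 1) * Complex.Gamma (1 + h 0 - h 2)) *
        hypF (upperF 1 h) (lowerF 1 h) ((-1) ^ (1 + 1))) := by
  have ha' := not_isNonposInt_of_one_add h0 ha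
  have hn1 : ¬ IsNonposInt (1 + h 0 - h 1) := hnp 0 (by omega)
  have hn2 : ¬ IsNonposInt (1 + h 0 - h 2) := hnp 1 (by omega)
  have hn3 : ¬ IsNonposInt (1 + h 0 - h 3) := hnp 2 (by omega)
  have hbeta : ∀ j, ¬ IsNonposInt (1 + h 0 - h j) → ∀ k,
      baileyBeta (h 0) (vwpAlpha (h 0) (fun _ => h j) 0) k =
        1 / (k.factorial * poch (1 + h 0 - h j) k) := by
    intro j hj k
    rw [eq_div_iff (mul_ne_zero (factorial_cast_ne_zero k) (poch_ne_zero hj k)), mul_comm]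
    exact baileyBeta_vwpAlpha_zero (c := fun _ => h j) h0 ha hj k
  have hT := terminatingIdentity h0 ha 0 (fun i => h (i + 3))
    (fun i hi => by obtain rfl : i = 0 := by omega
                    exact hnp 2 (by omega)) (fun i hi => absurd hi (by omega))
  have hw : (h 1).re < (wpExponent (h 0) (fun i => h (i + 2)) 0).re := by
    simp [wpExponent] at h123 ⊢
    linarith
  have hJ := hasSum_nestedIntegral_of_terminatingIdentity (c := fun i => h (i + 2)) hT hpos hw.le
    (fun _ => hw)
  have e3 : vwpAlpha (h 0) (fun i => h (i + 3)) 0 = vwpAlpha (h 0) (fun _ => h 3) 0 := by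
    funext l; simp [vwpAlpha]
  -- `g1` evaluates the integral. `g2` evaluates the left side of Bailey's lemma for the pair `h 2`,
  -- `h 3`, whose `β_k` is `1 / (k! (1 + h 0 - h 1)_k)`.
  have g1 := (hasSum_gaussTerm (a := h 1) (b := h 2) hn3
    (by convert! h123 using 2; ring)).mul_left (betaProd (h 0) (fun i => h (i + 2)) 1)
  have g2 := hasSum_gaussTerm (a := h 2) (b := h 3) hn1 h123
  have h23 : 0 < (1 + h 0 - h 2 - h 3).re := by
    have := (hpos 0 (by omega)).2
    simp [wpExponent] at this ⊢
    linarith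
  have hα : PolyBound (vwpAlpha (h 0) (fun _ => h 1) 0) _ :=
    (polyBound_vwp_mul_prod ha' (fun _ => h 1) 1
      (fun i hi => hnp 0 (by omega))).congr_norm fun l => norm_vwpAlpha _ _ _ _
  have hB := hasSum_bailey ha hn2 hn3 h23
    (hα.summable_rpow_mul_norm (by
      simp [Finset.sum_range_succ] at hlt ⊢
      linarith))
  have eB : (fun k => poch (h 2) k * poch (h 3) k *
      baileyBeta (h 0) (vwpAlpha (h 0) (fun _ => h 1) 0) k) =
      gaussTerm (h 2) (h 3) (1 + h 0 - h 1) := by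
    funext k
    rw [hbeta 1 hn1, gaussTerm]; ring
  rw [eB] at hB
  have eJ : (fun k => betaProd (h 0) (fun i => h (i + 2)) 1 *
      (poch (h 1) k * poch (h 2) k * baileyBeta (h 0) (vwpAlpha (h 0) (fun i => h (i + 3)) 0) k)) =
      fun k => betaProd (h 0) (fun i => h (i + 2)) 1 *
        gaussTerm (h 1) (h 2) (1 + h 0 - h 3) k := by
    funext k
    rw [e3, hbeta 3 hn3, gaussTerm]; ring
  have hJ' := hJ.unique (eJ ▸ g1)
  rw [hJ']
  congr 1
  have eF : hypF (upperF 1 h) (lowerF 1 h) ((-1) ^ (1 + 1)) = ∑' l, poch (h 2) l /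
      poch (1 + h 0 - h 2) l * (poch (h 3) l / poch (1 + h 0 - h 3) l) *
        vwpAlpha (h 0) (fun _ => h 1) 0 l := by
    refine tsum_congr fun l => ?_
    rw [hypTerm_eq, vwpAlpha, pow_mul]
    simp [Finset.prod_range_succ]
    ring
  rw [eF, show 1 + h 0 - h 3 - h 1 - h 2 = 1 + h 0 - h 1 - h 2 - h 3 by ring,
    show 1 + h 0 - h 3 - h 1 = 1 + h 0 - h 1 - h 3 by ring,
    show 1 + h 0 - h 3 - h 2 = 1 + h 0 - h 2 - h 3 by ring]
  exact Gamma_dougall_eq (Gamma_ne_zero_of_not_isNonposInt hn1)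
    (Gamma_ne_zero_of_not_isNonposInt hn2) (Gamma_ne_zero_of_not_isNonposInt hn3)
    (Gamma_ne_zero_of_not_isNonposInt h12) (Complex.Gamma_ne_zero_of_re_pos h23) (hB.unique g2)

end VasilyevZudilin

open VasilyevZudilin in
theorem theorem1 (m : ℕ) (hm : 1 ≤ m) (h : ℕ → ℂ)
    (hseries : 1 + (h 0).re > 2 / ((m : ℝ) + 1) * ∑ j ∈ Finset.Icc 1 (m + 2), (h j).re)
    (hpos : ∀ j ∈ Finset.Icc 2 (m + 1), (1 + h 0 - h (j + 1)).re > (h j).re ∧ (h j).re > 0)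
    (hint : (1 + h 0 - h 3 - h 2).re ≥ (h 1).re)
    (hne : h 0 ≠ 0)
    (hone : m = 1 →
      ¬ VasilyevZudilin.IsNonposInt (h 0) ∧
      ¬ VasilyevZudilin.IsNonposInt (1 + h 0 - h 1) ∧
      ¬ VasilyevZudilin.IsNonposInt (1 + h 0 - h 2) ∧
      ¬ VasilyevZudilin.IsNonposInt (1 + h 0 - h 1 - h 2)) :
    -- both sides are well-defined
    MeasureTheory.IntegrableOn
      (VasilyevZudilin.vasIntegrand (VasilyevZudilin.upperJ m h) (VasilyevZudilin.lowerJ m h) 1)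
      (Set.Icc (0 : Fin m → ℝ) 1) MeasureTheory.volume ∧
    (∀ i, ¬ VasilyevZudilin.IsNonposInt (VasilyevZudilin.lowerF m h i)) ∧
    Summable (VasilyevZudilin.hypTerm (VasilyevZudilin.upperF m h) (VasilyevZudilin.lowerF m h)
      ((-1) ^ (m + 1))) ∧
    ¬ VasilyevZudilin.IsNonposInt (1 + h 0) ∧
    (∀ j ∈ Finset.Icc 2 (m + 1), ¬ VasilyevZudilin.IsNonposInt (h j)) ∧
    (∀ j ∈ Finset.Icc 1 (m + 1), ¬ VasilyevZudilin.IsNonposInt (1 + h 0 - h j - h (j + 1))) ∧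
    -- and they are equal
    VasilyevZudilin.vasJ (VasilyevZudilin.upperJ m h) (VasilyevZudilin.lowerJ m h) 1 =
      Complex.Gamma (1 + h 0) * (∏ j ∈ Finset.Icc 2 (m + 1), Complex.Gamma (h j)) /
        (∏ j ∈ Finset.Icc 1 (m + 2), Complex.Gamma (1 + h 0 - h j)) *
      (∏ j ∈ Finset.Icc 1 (m + 1), Complex.Gamma (1 + h 0 - h j - h (j + 1))) *
      VasilyevZudilin.hypF (VasilyevZudilin.upperF m h) (VasilyevZudilin.lowerF m h)
        ((-1) ^ (m + 1)) := by
  have hpos' : ∀ i < m, 0 < (h (i + 2)).re ∧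
      0 < (wpExponent (h 0) (fun i => h (i + 2)) i).re := fun i hi => by
    obtain ⟨h1, h2⟩ := hpos (i + 2) (by simp; omega)
    refine ⟨h2, ?_⟩
    simp [wpExponent] at h1 ⊢
    linarith
  have hlt := series_exponent_lt hseries
  obtain ⟨ha, hnp, hnp2, hJ, hw, hw1⟩ : ¬ IsNonposInt (1 + h 0) ∧
      (∀ i < m + 2, ¬ IsNonposInt (1 + h 0 - h (i + 1))) ∧
      (∀ i < m + 1, ¬ IsNonposInt (1 + h 0 - h (i + 1) - h (i + 2))) ∧
      nestedIntegral (fun i => h (i + 2)) (wpExponent (h 0) fun i => h (i + 2)) m (h 1) =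
        betaProd (h 0) (fun i => h (i + 2)) m *
        (Complex.Gamma (1 + h 0) * Complex.Gamma (1 + h 0 - h 1 - h 2) /
          (Complex.Gamma (1 + h 0 - h 1) * Complex.Gamma (1 + h 0 - h 2)) *
          hypF (upperF m h) (lowerF m h) ((-1) ^ (m + 1))) ∧
      (h 1).re ≤ (wpExponent (h 0) (fun i => h (i + 2)) 0).re ∧
      (m = 1 → (h 1).re < (wpExponent (h 0) (fun i => h (i + 2)) 0).re) := by
    have hw : (h 1).re ≤ (wpExponent (h 0) (fun i => h (i + 2)) 0).re := hint
    obtain ⟨p0, q0⟩ := hpos' 0 (by omega)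
    have hgap : ∀ i < m, ¬ IsNonposInt (1 + h 0 - h (i + 2) - h (i + 3)) := fun i hi => by
      refine not_isNonposInt_of_re_pos ?_
      have := (hpos' i hi).2
      simp [wpExponent] at this ⊢
      linarith
    have hhigh : ∀ i < m, ¬ IsNonposInt (1 + h 0 - h (i + 3)) := fun i hi => by
      refine not_isNonposInt_of_re_pos ?_
      have := hpos' i hi
      simp [wpExponent] at this ⊢
      linarith
    obtain rfl | ⟨k, rfl⟩ : m = 1 ∨ ∃ k, m = k + 2 := by
      rcases m with _ | _ | k
      · omega
      · exact Or.inl rfl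
      · exact Or.inr ⟨k, rfl⟩
    · obtain ⟨n0, n1, n2, n12⟩ := hone rfl
      have ha : ¬ IsNonposInt (1 + h 0) := by
        rw [add_comm]; exact not_isNonposInt_add_one n0
      have hnp : ∀ i < 3, ¬ IsNonposInt (1 + h 0 - h (i + 1)) := by
        intro i hi
        interval_cases i
        exacts [n1, n2, hhigh 0 (by omega)]
      -- For `m = 1` the convergence hypothesis of the series is this very inequality.
      have h123 : 0 < (1 + h 0 - h 1 - h 2 - h 3).re := by
        simp [Finset.sum_range_succ] at hlt ⊢
        linarith
      refine ⟨ha, hnp, fun i hi => ?_, nestedIntegral_one_eq hne ha hnp n12 hpos' h123 hlt, hw,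
        fun _ => ?_⟩
      · rcases i with _ | i
        · exact n12
        · exact hgap i (by omega)
      · simp [wpExponent] at h123 ⊢
        linarith
    · obtain ⟨p1, q1⟩ := hpos' 1 (by omega)
      simp [wpExponent] at p0 q0 p1 q1 hw
      have ha : ¬ IsNonposInt (1 + h 0) := not_isNonposInt_of_re_pos (by simp; linarith)
      -- From `Re (h 1) ≤ Re(1 + h 0 - h 3 - h 2)` and `Re (h 3) > 0`; the latter is available only
      -- for `m ≥ 2`.
      have h12 : 0 < (1 + h 0 - h 1 - h 2).re := by simp; linarith
      have hnp : ∀ i < k + 4, ¬ IsNonposInt (1 + h 0 - h (i + 1)) := by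
        intro i hi
        rcases i with _ | _ | i
        · exact not_isNonposInt_of_re_pos (by simp; linarith)
        · exact not_isNonposInt_of_re_pos (by simp; linarith)
        · exact hhigh i (by omega)
      refine ⟨ha, hnp, fun i hi => ?_, nestedIntegral_eq_of_two_le hne ha hnp hpos' hint h12 hlt,
        hint, fun h => absurd h (by omega)⟩
      rcases i with _ | i
      · exact not_isNonposInt_of_re_pos h12
      · exact hgap i (by omega)
  have ha' := not_isNonposInt_of_one_add hne ha
  obtain ⟨m, rfl⟩ : ∃ k, m = k + 1 := ⟨m - 1, by omega⟩
  refine ⟨?_, fun i => ?_, ?_, ha, fun j hj => ?_, fun j hj => ?_, ?_⟩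
  · rw [MeasureTheory.IntegrableOn, restrict_Icc_eq_openCube]
    simp only [funext (vasIntegrand_eq (m + 1) h)]
    exact integrableOn_betaWeight_mul_nested (fun i hi => (hpos' i hi).1)
      (fun i hi => (hpos' i hi).2) hw (fun h => hw1 (by omega))
  · refine Fin.cases ?_ (fun i => ?_) i
    · exact not_isNonposInt_half ha'
    · exact hnp i i.2
  · refine PolyBound.summable ((polyBound_vwp_mul_prod ha' (fun i => h (i + 1)) (m + 1 + 2)
      hnp).congr_norm fun k => ?_) hlt
    rw [hypTerm_eq, norm_mul]
    simp
  · exact not_isNonposInt_of_re_pos (hpos j hj).2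
  · obtain ⟨i, rfl⟩ : ∃ i, j = i + 1 := ⟨j - 1, by have := (Finset.mem_Icc.1 hj).1; omega⟩
    exact hnp2 i (by have := (Finset.mem_Icc.1 hj).2; omega)
  · rw [gamma_prefactor_eq hpos', mul_assoc, ← hJ, vasJ, restrict_Icc_eq_openCube]
    simp only [funext (vasIntegrand_eq (m + 1) h)]
    rfl
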